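/- **Theorem 1.2.** Let $p>5$ be an integer and let $\varrho$ be the substitution $a\mapsto a^p,\ b\mapsto bab^4$ on $\mathcal A=\{a,b\}$. Let $\mathbb X_\varrho\subset\mathcal A^{\mathbb Z}$ be its subshift, i.e. the set of all $w$ such that every finite subword of $w$ is a subword of $\varrho^n(c)$ for some $c\in\mathcal A$, $n\ge 1$; let $(Sw)_n=w_{n+1}$ be the shift, and let $\overline w=a^\infty.\varrho^\infty(b)$, i.e. $\overline w_n=a$ for $n<0$ and $\overline w_0\overline w_1\cdots=\lim_{k\to\infty}\varrho^k(b)$. For injective $V:\mathcal A\to\mathbb R$ and $w\in\mathcal A^{\mathbb Z}$ let $H_w$ be the Schrödinger operator $(H_w\psi)_n=\psi_{n-1}+\psi_{n+1}+V(w_n)\psi_n$ on $\ell^2(\mathbb Z)$, and let $\sigma_{\mathrm{pp}}(H_w)$ be the closure of its set of eigenvalues. Then: 1. $\varrho$ is almost primitive: $a$ is the only letter mapped by $\varrho$ to a power of itself; there is $k\ge1$ such that every letter occurs in $\varrho^k(c)$ for every letter $c\ne a$; and every power $a^n$ occurs in some element of $\mathbb X_\varrho$. 2. $\overline w\in\mathbb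 X_\varrho$, $\overline w$ is eventually periodic (to at least one side), $\overline w\ne a^{\mathbb Z}$, and the orbit $\operatorname{Orb}(\overline w)=\{S^n\overline w: n\in\mathbb Z\}$ is dense in $\mathbb X_\varrho$. 3. There are non-zero non-atomic shift-invariant Borel measures $\nu$ on $\mathbb X_\varrho$ that are finite on every clopen set not containing $a^{\mathbb Z}$. 4. There are $V(a),V(b)\in\mathbb R$ with $V(a)\neq V(b)$ such that $H_{\overline w}$ has a real eigenvalue with an eigenvector $\psi\in\ell^2(\mathbb Z)$ decaying exponentially on both sides ($|\psi_n|\le Ce^{-\gamma|n|}$ for all $n\in\mathbb Z$, with some $C,\gamma>0$); the same holds for $H_w$ for every $w\in\operatorname{Orb}(\overline w)$; and at the same time, for each $\nu$ as in 3, $\sigma_{\mathrm{pp}}(H_w)=\varnothing$ (so $H_w$ has no eigenvalues) for $\nu$-almost every $w$. -/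

import Mathlib

open scoped ENNReal

/-! ### Bi-infinite sequences and subshifts -/

/-- `shift k` is the `k`-th power `S ^ k` of the left shift `(S w) n = w (n + 1)`. -/
def shift {A : Type*} (k : ℤ) (w : ℤ → A) : ℤ → A := fun n => w (n + k)

/-- The two-sided orbit `{S ^ k w | k ∈ ℤ}`. -/
def orbit {A : Type*} (w : ℤ → A) : Set (ℤ → A) := Set.range fun k : ℤ => shift k w

/-- The finite word `w i, w (i + 1), …, w (i + n - 1)`. -/
def subword {A : Type*} (w : ℤ → A) (i : ℤ) (n : ℕ) : List A :=
  List.ofFn fun j : Fin n => w (i + (j : ℕ))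

/-- The bi-infinite sequence with all entries equal to `a`. -/
def constSeq {A : Type*} (a : A) : ℤ → A := fun _ => a

/-- `w` is periodic from some position on, to the right or to the left. -/
def EventuallyPeriodic {A : Type*} (w : ℤ → A) : Prop :=
  (∃ N q : ℤ, 0 < q ∧ ∀ n, N ≤ n → w (n + q) = w n) ∨
    (∃ N q : ℤ, 0 < q ∧ ∀ n, n ≤ N → w (n - q) = w n)

/-! ### Substitutions

A substitution assigns to each letter a non-empty word; it is extended to words by concatenation,
that is by `List.flatMap`. -/

/-- The word `σ ^ n (c)`. -/
def substIter {A : Type*} (σ : A → List A) (n : ℕ) (c : A) : List A :=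
  (fun u : List A => u.flatMap σ)^[n] [c]

/-- A word is admitted if it is a subword of `σ ^ n (c)` for some letter `c` and some `n ≥ 1`. -/
def Admitted {A : Type*} (σ : A → List A) (v : List A) : Prop :=
  ∃ (c : A) (n : ℕ), 1 ≤ n ∧ v <:+: substIter σ n c

/-- The subshift of a substitution: all finite subwords are admitted. -/
def substSubshift {A : Type*} (σ : A → List A) : Set (ℤ → A) :=
  {w | ∀ (i : ℤ) (n : ℕ), Admitted σ (subword w i n)}

/-- A word is legal if it occurs in some point of the subshift. -/
def Legal {A : Type*} (σ : A → List A) (v : List A) : Prop :=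
  ∃ w ∈ substSubshift σ, ∃ i : ℤ, subword w i v.length = v

/-- The eventually periodic points of the subshift. -/
def substSubshiftEP {A : Type*} (σ : A → List A) : Set (ℤ → A) :=
  {w | w ∈ substSubshift σ ∧ EventuallyPeriodic w}

/-- Almost primitive substitutions with distinguished letter `a`. -/
structure IsAlmostPrimitive {A : Type*} (σ : A → List A) (a : A) : Prop where
  /-- the images of letters are non-empty words -/
  ne_nil : ∀ c, σ c ≠ []
  /-- `σ a` is a power of `a` -/
  map_fixed : ∃ p : ℕ, 1 ≤ p ∧ σ a = List.replicate p a
  /-- `a` is the only letter that is mapped to a power of itself -/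
  unique_fixed : ∀ c, (∃ q : ℕ, 1 ≤ q ∧ σ c = List.replicate q c) → c = a
  /-- every letter occurs in `σ ^ k (c)`, for one `k ≥ 1` and all `c ≠ a` -/
  primitive : ∃ k : ℕ, 1 ≤ k ∧ ∀ b c : A, c ≠ a → b ∈ substIter σ k c
  /-- every power of `a` is legal -/
  legal_pow : ∀ n : ℕ, Legal σ (List.replicate n a)

/-- `ν` is a non-trivial non-atomic shift-invariant Borel measure on the subshift of `σ` (viewed as
a measure on the full sequence space that gives no mass to the complement of the subshift), finite
on every clopen set that does not contain the constant sequence `a`. It may be infinite. -/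
structure IsNonatomicInvariantMeasure {A : Type*} [TopologicalSpace A] [MeasurableSpace A]
    (σ : A → List A) (a : A) (ν : MeasureTheory.Measure (ℤ → A)) : Prop where
  ne_zero : ν ≠ 0
  concentrated : ν (substSubshift σ)ᶜ = 0
  invariant : MeasureTheory.MeasurePreserving (shift 1) ν ν
  nonatomic : ∀ w : ℤ → A, ν {w} = 0
  finite_of_isClopen : ∀ C : Set (ℤ → A), IsClopen C → constSeq a ∉ C → ν C < ∞

/-! ### Discrete Schrödinger operators -/

/-- The Hilbert space `ℓ²(ℤ)`. -/
abbrev L2Z : Type := lp (fun _ : ℤ => ℂ) 2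

theorem memlp_translate (k : ℤ) (ψ : L2Z) : Memℓp (fun n : ℤ => ψ (n + k)) 2 := by
  have h := (memℓp_gen_iff (p := 2) (by norm_num)).1 (lp.memℓp ψ)
  exact memℓp_gen ((Equiv.addRight k).summable_iff.2 h)

/-- Translation `(translateL2 k ψ) n = ψ (n + k)` on `ℓ²(ℤ)`. -/
noncomputable def translateL2 (k : ℤ) : L2Z →L[ℂ] L2Z :=
  LinearMap.mkContinuous
    { toFun := fun ψ => ⟨fun n : ℤ => ψ (n + k), memlp_translate k ψ⟩
      map_add' := fun _ _ => rfl
      map_smul' := fun _ _ => rfl } 1 (by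
    intro ψ
    rw [one_mul, lp.norm_eq_tsum_rpow (by norm_num), lp.norm_eq_tsum_rpow (by norm_num)]
    exact le_of_eq (congrArg (fun t : ℝ => t ^ (1 / (2 : ℝ≥0∞).toReal))
      ((Equiv.addRight k).tsum_eq fun n : ℤ => ‖ψ n‖ ^ (2 : ℝ≥0∞).toReal)))

theorem translateL2_apply (k : ℤ) (ψ : L2Z) (n : ℤ) : translateL2 k ψ n = ψ (n + k) := rfl

/-- The multiplication operator `ψ ↦ (V (w n) * ψ n)` on `ℓ²(ℤ)`. -/
noncomputable def potentialL2 {A : Type*} [Fintype A] (V : A → ℝ) (w : ℤ → A) : L2Z →L[ℂ] L2Z :=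
  lp.mapCLM 2 (fun n : ℤ => (V (w n) : ℂ) • ContinuousLinearMap.id ℂ ℂ) (K := ∑ c, |V c|)
    (Finset.sum_nonneg fun c _ => abs_nonneg (V c)) (by
    intro n
    rw [norm_smul, ContinuousLinearMap.norm_id, mul_one, Complex.norm_real, Real.norm_eq_abs]
    exact Finset.single_le_sum (f := fun c => |V c|) (fun c _ => abs_nonneg _)
      (Finset.mem_univ (w n)))

theorem potentialL2_apply {A : Type*} [Fintype A] (V : A → ℝ) (w : ℤ → A) (ψ : L2Z) (n : ℤ) :
    potentialL2 V w ψ n = (V (w n) : ℂ) * ψ n := by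
  simp [potentialL2]

/-- The Schrödinger operator `(H ψ) n = ψ (n - 1) + ψ (n + 1) + V (w n) * ψ n` on `ℓ²(ℤ)`. -/
noncomputable def schrodinger {A : Type*} [Fintype A] (V : A → ℝ) (w : ℤ → A) : L2Z →L[ℂ] L2Z :=
  translateL2 (-1) + translateL2 1 + potentialL2 V w

theorem schrodinger_apply {A : Type*} [Fintype A] (V : A → ℝ) (w : ℤ → A) (ψ : L2Z) (n : ℤ) :
    schrodinger V w ψ n = ψ (n - 1) + ψ (n + 1) + (V (w n) : ℂ) * ψ n := by
  simp only [schrodinger, _root_.add_apply, lp.coeFn_add, Pi.add_apply,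
    translateL2_apply, potentialL2_apply, sub_eq_add_neg]

/-- `ψ` is an eigenvector of `H`, with eigenvalue `E`. -/
def IsEigenvector (H : L2Z →L[ℂ] L2Z) (E : ℂ) (ψ : L2Z) : Prop :=
  Module.End.HasEigenvector (H : Module.End ℂ L2Z) E ψ

/-- The pure point spectrum: the closure of the set of eigenvalues. -/
def purePointSpectrum (H : L2Z →L[ℂ] L2Z) : Set ℂ :=
  closure {E : ℂ | Module.End.HasEigenvalue (H : Module.End ℂ L2Z) E}

/-- `ψ n` tends to `0` exponentially fast as `n → ∞` and as `n → -∞`. -/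
def ExponentiallyDecaying (ψ : L2Z) : Prop :=
  ∃ C γ : ℝ, 0 < C ∧ 0 < γ ∧ ∀ n : ℤ, ‖ψ n‖ ≤ C * Real.exp (-γ * |(n : ℝ)|)

/-! ### The example -/

/-- The two-letter alphabet. -/
inductive Letter : Type
  | a
  | b
  deriving DecidableEq

instance : Fintype Letter := ⟨{Letter.a, Letter.b}, fun c => by cases c <;> decide⟩

instance : TopologicalSpace Letter := ⊥
instance : DiscreteTopology Letter := ⟨rfl⟩
instance : MeasurableSpace Letter := ⊤

/-- The substitution `a ↦ a ^ p`, `b ↦ b a b ^ 4`. -/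
def rho (p : ℕ) : Letter → List Letter
  | .a => List.replicate p .a
  | .b => [.b, .a, .b, .b, .b, .b]

/-- The sequence `a ^ ∞ . ρ ^ ∞ (b)`: its entries at negative positions are `a`, and its entries at
positions `n ≥ 0` are those of the one-sided limit of the words `ρ ^ k (b)`, each of which is a
prefix of the next one (the word `ρ ^ (n + 1) (b)` has more than `n` letters). -/
def wbar (p : ℕ) : ℤ → Letter
  | .ofNat n => (substIter (rho p) (n + 1) .b).getD n .a
  | .negSucc _ => .a

theorem substIter_prefix_succ (p k : ℕ) :
    substIter (rho p) k .b <+: substIter (rho p) (k + 1) .b := by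
  induction k with
  | zero => exact ⟨[.a, .b, .b, .b, .b], rfl⟩
  | succ k ih =>
    obtain ⟨t, ht⟩ := ih
    refine ⟨t.flatMap (rho p), ?_⟩
    rw [substIter, substIter, Function.iterate_succ_apply', Function.iterate_succ_apply' _ (k + 1),
      ← List.flatMap_append]
    exact congrArg (fun u : List Letter => u.flatMap (rho p)) ht

theorem substIter_prefix (p : ℕ) {k m : ℕ} (h : k ≤ m) :
    substIter (rho p) k .b <+: substIter (rho p) m .b := by
  induction m, h using Nat.le_induction with
  | base => exact List.prefix_refl _
  | succ m _ ih => exact ih.trans (substIter_prefix_succ p m)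

theorem lt_count_substIter (p k : ℕ) : k < (substIter (rho p) k .b).count .b := by
  have key : ∀ u : List Letter, (u.flatMap (rho p)).count .b = 5 * u.count .b := by
    intro u
    induction u with
    | nil => rfl
    | cons c u ih =>
      rw [List.flatMap_cons, List.count_append, ih]
      cases c with
      | a => simp [rho, List.count_replicate]
      | b =>
        simp [rho]
        ring
  induction k with
  | zero => exact Nat.zero_lt_one
  | succ k ih =>
    rw [substIter, Function.iterate_succ_apply', key]
    rw [substIter] at ih
    omega

/-- The words `ρ ^ k (b)` are prefixes of the right half of `wbar p`. -/
theorem wbar_eq (p k n : ℕ) (h : n < (substIter (rho p) k .b).length) :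
    wbar p n = (substIter (rho p) k .b)[n] := by
  have hn : n < (substIter (rho p) (n + 1) .b).length :=
    lt_of_lt_of_le ((Nat.lt_succ_self n).trans (lt_count_substIter p (n + 1)))
      List.count_le_length
  change (substIter (rho p) (n + 1) .b).getD n .a = _
  rw [List.getD_eq_getElem _ _ hn]
  rcases le_total k (n + 1) with hk | hk
  · exact ((substIter_prefix p hk).getElem h).symm
  · exact (substIter_prefix p hk).getElem hn

/-! ### The words `ρ ^ k (b)` -/

/-! Write B_k for ρ^k(b) and L_k for its length. Everything rests on B_{k+1} = B_k a^{p^k} B_k B_k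
B_k B_k (`substIter_rho_b_succ`), together with L_k ≤ p^k, which follows from p > 5: a gap is at
least as long as the block before it (`blockLen_le_pow`).

Eigenvector: take energy 0 and V = -t. The parameters are chosen so that the transfer matrix of a is
hyperbolic, while the matrix M of B_1 satisfies M² = -1 and swaps the two eigenlines of a
(`exists_hopping_values`). The solution that decays to the left arrives at the origin on the
expanding line; B_1 throws it onto the contracting line, and the next gap shrinks it. By induction
every B_{k+1} swaps the lines and squares to -1, so four consecutive copies act as the identity and
undo nothing that the gap has gained (`carries_block`). Gap lengths are comparable to positions,
hence the decay is exponential (`norm_solState_le`). Translation covers the orbit.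

No eigenvalues almost surely: the power B_k^4 invites Gordon's three-block argument
(`not_isEigenvector_of_frequently_repeatsThrice`). Every b of a point of the subshift lies in a copy
of B_{k+1}, in one of its five copies of B_k. By invariance these five carry equal mass, and around
the second member of B_k^4 the point is a threefold repetition. So at least a fifth of the mass of
the cylinder of b is repetitive at every scale k (`measure_cylinderB_le`). Applied to the measure
restricted to the non-repetitive points, this forces that restriction to vanish
(`ae_mem_repetitiveSet`); no ergodicity is needed.

Existence of a measure: count the translates of `wbar p` along B_k, normalise by the number of b's,
and pass to an ultrafilter limit on clopen sets avoiding a^ℤ. Compactness makes the limit countably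
subadditive (`exists_measure_of_tendsto`), and aperiodicity excludes atoms
(`measure_singleton_eq_zero`). -/

theorem iterate_flatMap_eq {A : Type*} (σ : A → List A) (k : ℕ) (u : List A) :
    (fun u : List A => u.flatMap σ)^[k] u = u.flatMap (substIter σ k) := by
  induction k with
  | zero => exact (List.flatMap_singleton' u).symm
  | succ k ih =>
    rw [Function.iterate_succ_apply', ih, List.flatMap_assoc]
    refine congrArg (u.flatMap ·) (funext fun c => ?_)
    exact (Function.iterate_succ_apply' (fun u : List A => u.flatMap σ) k [c]).symm

theorem substIter_rho_a (p k : ℕ) : substIter (rho p) k .a = List.replicate (p ^ k) .a := by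
  induction k with
  | zero => rfl
  | succ k ih =>
    rw [substIter, Function.iterate_succ_apply', ← substIter, ih]
    rw [List.eq_replicate_iff]
    simp [rho, List.length_flatMap, pow_succ]

theorem substIter_rho_b_succ (p k : ℕ) :
    substIter (rho p) (k + 1) .b = substIter (rho p) k .b ++ (List.replicate (p ^ k) .a ++
      (substIter (rho p) k .b ++ (substIter (rho p) k .b ++
      (substIter (rho p) k .b ++ substIter (rho p) k .b)))) := by
  conv_lhs => rw [substIter, Function.iterate_succ_apply, iterate_flatMap_eq]
  simp [rho, substIter_rho_a]

/-- The length of `ρ ^ k (b)`. -/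
def blockLen (p k : ℕ) : ℕ := (substIter (rho p) k .b).length

theorem blockLen_succ (p k : ℕ) : blockLen p (k + 1) = 5 * blockLen p k + p ^ k := by
  rw [blockLen, blockLen, substIter_rho_b_succ]
  simp only [List.length_append, List.length_replicate]
  ring

theorem lt_blockLen (p k : ℕ) : k < blockLen p k :=
  (lt_count_substIter p k).trans_le List.count_le_length

theorem blockLen_pos (p k : ℕ) : 0 < blockLen p k := (Nat.zero_le k).trans_lt (lt_blockLen p k)

/-- Induction step: 5 L_k + p^k ≤ 6 p^k ≤ p^{k+1}. This is where p > 5 enters. -/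
theorem blockLen_le_pow {p : ℕ} (hp : 5 < p) (k : ℕ) : blockLen p k ≤ p ^ k := by
  induction k with
  | zero => rfl
  | succ k ih =>
    rw [blockLen_succ, pow_succ]
    nlinarith

theorem blockLen_mono (p : ℕ) : Monotone (blockLen p) :=
  monotone_nat_of_le_succ fun k => by rw [blockLen_succ]; omega

/-- The right half of `wbar p`. -/
def rightSeq (p n : ℕ) : Letter := wbar p n

theorem wbar_natCast (p n : ℕ) : wbar p n = rightSeq p n := rfl

theorem wbar_of_neg (p : ℕ) {n : ℤ} (h : n < 0) : wbar p n = .a := by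
  obtain ⟨m, rfl⟩ := Int.eq_negSucc_of_lt_zero h
  rfl

theorem rightSeq_eq (p k n : ℕ) (h : n < blockLen p k) :
    rightSeq p n = (substIter (rho p) k .b)[n]'h := wbar_eq p k n h

theorem rightSeq_zero (p : ℕ) : rightSeq p 0 = .b := rightSeq_eq p 0 0 Nat.one_pos

theorem rightSeq_gap (p k : ℕ) {j : ℕ} (hj : j < p ^ k) : rightSeq p (blockLen p k + j) = .a := by
  rw [rightSeq_eq p (k + 1) _ (by rw [blockLen_succ]; omega)]
  simp only [substIter_rho_b_succ, blockLen]
  rw [List.getElem_append_right (by omega), List.getElem_append_left (by simpa using hj)]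
  simp

theorem rightSeq_copy (p k : ℕ) {d j : ℕ} (hd : d < 4) (hj : j < blockLen p k) :
    rightSeq p (blockLen p k + p ^ k + d * blockLen p k + j) = rightSeq p j := by
  rw [rightSeq_eq p (k + 1) _ (by rw [blockLen_succ]; interval_cases d <;> omega),
    rightSeq_eq p k j hj]
  simp only [substIter_rho_b_succ, blockLen] at hj ⊢
  rw [List.getElem_append_right (by omega), List.getElem_append_right (by simp; omega)]
  simp only [List.length_replicate]
  interval_cases d
  · rw [List.getElem_append_left (by omega)]
    congr 1; omega
  · rw [List.getElem_append_right (by omega), List.getElem_append_left (by omega)]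
    congr 1; omega
  · rw [List.getElem_append_right (by omega), List.getElem_append_right (by omega),
      List.getElem_append_left (by omega)]
    congr 1; omega
  · rw [List.getElem_append_right (by omega), List.getElem_append_right (by omega),
      List.getElem_append_right (by omega)]
    congr 1; omega

/-- A position in `ρ ^ (k + 1) (b)` carrying the letter `b` lies in one of the five copies of
`ρ ^ k (b)`. -/
theorem exists_copy_of_rightSeq_eq_b (p k : ℕ) {s : ℕ} (hs : s < blockLen p (k + 1))
    (hb : rightSeq p s = .b) :
    ∃ j < blockLen p k, rightSeq p j = .b ∧
      (s = j ∨ ∃ d < 4, s = blockLen p k + p ^ k + d * blockLen p k + j) := by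
  rw [blockLen_succ] at hs
  have hL := blockLen_pos p k
  set L := blockLen p k with hLdef
  rcases lt_or_ge s L with h1 | h1
  · exact ⟨s, h1, hb, .inl rfl⟩
  rcases lt_or_ge s (L + p ^ k) with h2 | h2
  · have := rightSeq_gap p k (j := s - L) (by omega)
    rw [← hLdef, Nat.add_sub_cancel' h1, hb] at this
    cases this
  have hdm := Nat.div_add_mod (s - (L + p ^ k)) L
  have hmod := Nat.mod_lt (s - (L + p ^ k)) hL
  have hdiv : (s - (L + p ^ k)) / L < 4 := by
    rw [Nat.div_lt_iff_lt_mul hL]; omega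
  have hs' : s = L + p ^ k + (s - (L + p ^ k)) / L * L + (s - (L + p ^ k)) % L := by
    rw [mul_comm] at hdm; omega
  refine ⟨_, hmod, ?_, .inr ⟨_, hdiv, hs'⟩⟩
  rw [← rightSeq_copy p k hdiv hmod, ← hLdef, ← hs', hb]

theorem rightSeq_last (p k : ℕ) : rightSeq p (blockLen p k - 1) = .b := by
  induction k with
  | zero => exact rightSeq_zero p
  | succ k ih =>
    have hL := blockLen_pos p k
    have := rightSeq_copy p k (d := 3) (j := blockLen p k - 1) (by omega) (by omega)
    rw [← ih, ← this, blockLen_succ]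
    congr 1; omega

/-- A gap contains no b, so each b of B_{k+n+1} can be traced down to one of the five copies of
B_{k+n}; after n descents it sits in a copy of B_k. -/
theorem rightSeq_covered (p k s : ℕ) (hb : rightSeq p s = .b) :
    ∃ t, t ≤ s ∧ s < t + blockLen p k ∧ ∀ m < blockLen p k, rightSeq p (t + m) = rightSeq p m := by
  have key : ∀ n, ∀ s < blockLen p (k + n), rightSeq p s = .b →
      ∃ t, t ≤ s ∧ s < t + blockLen p k ∧ t + blockLen p k ≤ blockLen p (k + n) ∧
        ∀ m < blockLen p k, rightSeq p (t + m) = rightSeq p m := by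
    intro n
    induction n with
    | zero => exact fun s hs _ => ⟨0, by omega, by simpa using hs, by simp, by simp⟩
    | succ n ih =>
      intro s hs hb
      obtain ⟨j, hj, hjb, h⟩ := exists_copy_of_rightSeq_eq_b p (k + n) hs hb
      obtain ⟨t, ht1, ht2, ht3, ht4⟩ := ih j hj hjb
      have hsucc := blockLen_succ p (k + n)
      rcases h with rfl | ⟨d, hd, rfl⟩
      · exact ⟨t, ht1, ht2, by rw [← add_assoc]; omega, ht4⟩
      · refine ⟨blockLen p (k + n) + p ^ (k + n) + d * blockLen p (k + n) + t, by omega, by omega,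
          ?_, fun m hm => ?_⟩
        · rw [← add_assoc k n 1]
          interval_cases d <;> omega
        · rw [add_assoc _ t m, rightSeq_copy p (k + n) hd (by omega), ht4 m hm]
  obtain ⟨t, h1, h2, -, h4⟩ := key s s ((lt_blockLen p s).trans_le (blockLen_mono p (by omega))) hb
  exact ⟨t, h1, h2, h4⟩

/-! ### The subshift -/

theorem substIter_infix_b (p : ℕ) (c : Letter) {n m : ℕ} (h : n < m) :
    substIter (rho p) n c <:+: substIter (rho p) m .b := by
  cases c with
  | b => exact (substIter_prefix p h.le).isInfix
  | a =>
    refine List.IsInfix.trans ?_ (substIter_prefix p (Nat.succ_le_of_lt h)).isInfix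
    rw [substIter_rho_a, substIter_rho_b_succ]
    exact ⟨_, _, by rw [List.append_assoc]⟩

theorem subword_length {A : Type*} (w : ℤ → A) (i : ℤ) (n : ℕ) : (subword w i n).length = n := by
  simp [subword]

theorem subword_getElem {A : Type*} (w : ℤ → A) (i : ℤ) (n j : ℕ) (h : j < (subword w i n).length) :
    (subword w i n)[j] = w (i + j) := by
  simp [subword]

/-- All words ρ^n(c), including the powers of a, are subwords of some ρ^m(b). Hence the right half
of `wbar p` alone already contains every admitted word. -/
theorem mem_substSubshift_rho_iff (p : ℕ) (w : ℤ → Letter) :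
    w ∈ substSubshift (rho p) ↔
      ∀ (i : ℤ) (n : ℕ), ∃ s : ℕ, ∀ m < n, w (i + m) = rightSeq p (s + m) := by
  refine forall₂_congr fun i n => ⟨?_, ?_⟩
  · rintro ⟨c, k, -, h⟩
    obtain ⟨x, y, hxy⟩ := h.trans (substIter_infix_b p c (Nat.lt_add_one k))
    have hlen := congrArg List.length hxy
    simp only [List.length_append, subword_length] at hlen
    refine ⟨x.length, fun m hm => ?_⟩
    rw [rightSeq_eq p (k + 1) _ (by rw [blockLen]; omega), ← subword_getElem w i n m
      (by rw [subword_length]; exact hm)]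
    simp only [← hxy, List.append_assoc]
    rw [List.getElem_append_right (by omega),
      List.getElem_append_left (by rw [subword_length]; omega)]
    congr 1; omega
  · rintro ⟨s, hs⟩
    have hlt := lt_blockLen p (s + n)
    refine ⟨.b, s + n + 1, by omega, ?_⟩
    refine List.IsInfix.trans ?_ (substIter_prefix p (Nat.le_succ (s + n))).isInfix
    have : subword w i n = ((substIter (rho p) (s + n) .b).drop s).take n := by
      refine List.ext_getElem ?_ fun j h1 h2 => ?_
      · rw [blockLen] at hlt
        simp only [subword_length, List.length_take, List.length_drop]; omega
      · rw [subword_length] at h1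
        rw [subword_getElem, hs j h1, rightSeq_eq p (s + n) _ (by omega)]
        rw [List.getElem_take, List.getElem_drop]; rfl
    rw [this]
    exact (List.take_prefix _ _).isInfix.trans (List.drop_suffix _ _).isInfix

theorem shift_mem_substSubshift {A : Type*} {σ : A → List A} {w : ℤ → A}
    (hw : w ∈ substSubshift σ) (k : ℤ) : shift k w ∈ substSubshift σ := by
  intro i n
  have : subword (shift k w) i n = subword w (i + k) n := by
    simp [subword, shift, add_right_comm]
  exact this ▸ hw (i + k) n

/-- The word `ρ ^ k (b)` occurs in `w` at position `i`. -/
def BlockAt (p k : ℕ) (w : ℤ → Letter) (i : ℤ) : Prop :=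
  ∀ m < blockLen p k, w (i + m) = rightSeq p m

theorem exists_blockAt {p : ℕ} {w : ℤ → Letter} (hw : w ∈ substSubshift (rho p)) {i : ℤ}
    (hi : w i = .b) (k : ℕ) :
    ∃ j < blockLen p k, rightSeq p j = .b ∧ BlockAt p k w (i - j) := by
  -- A radius of L_k on both sides leaves room for the whole copy of B_k around the b in the middle.
  obtain ⟨s, hs⟩ := (mem_substSubshift_rho_iff p w).1 hw (i - blockLen p k) (2 * blockLen p k + 1)
  have hs' : rightSeq p (s + blockLen p k) = .b := by
    rw [← hs _ (by omega), ← hi]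
    congr 1; omega
  obtain ⟨t, h1, h2, h3⟩ := rightSeq_covered p k _ hs'
  have hBlock : BlockAt p k w (i - (s + blockLen p k - t : ℕ)) := fun m hm => by
    rw [← h3 m hm, show t + m = s + (t + m - s) by omega, ← hs _ (by omega)]
    congr 1; omega
  have hj : s + blockLen p k - t < blockLen p k := by omega
  refine ⟨s + blockLen p k - t, hj, ?_, hBlock⟩
  rw [← hBlock _ hj, sub_add_cancel, hi]

theorem constSeq_mem (p : ℕ) (hp : 5 < p) : constSeq Letter.a ∈ substSubshift (rho p) := by
  refine (mem_substSubshift_rho_iff p _).2 fun i n => ⟨blockLen p n, fun m hm => ?_⟩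
  exact (rightSeq_gap p n (hm.trans (Nat.lt_pow_self (by omega)))).symm

theorem wbar_mem (p : ℕ) (hp : 5 < p) : wbar p ∈ substSubshift (rho p) := by
  refine (mem_substSubshift_rho_iff p _).2 fun i n => ?_
  rcases le_or_gt 0 i with hi | hi
  · lift i to ℕ using hi
    exact ⟨i, fun m _ => rfl⟩
  · obtain ⟨t, rfl⟩ : ∃ t : ℕ, i = -t := ⟨i.natAbs, by omega⟩
    have h1 : t + n < p ^ (t + n) := Nat.lt_pow_self (by omega)
    have h2 := lt_blockLen p (t + n)
    -- The window a^t followed by a prefix of the right half reappears at the end of the first gap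
    -- of B_{t+n+1}, just before the next copy of B_{t+n}.
    refine ⟨blockLen p (t + n) + (p ^ (t + n) - t), fun m hm => ?_⟩
    rcases lt_or_ge m t with h | h
    · rw [wbar_of_neg p (by omega), add_assoc, rightSeq_gap p _ (by omega)]
    · have := rightSeq_copy p (t + n) (d := 0) (j := m - t) (by omega) (by omega)
      rw [show -(t : ℤ) + m = (m - t : ℕ) by omega, wbar_natCast, ← this]
      congr 1; omega

/-- The sequences whose window of length `n` at `i` occurs in the right half of `wbar p`. -/
def windowSet (p : ℕ) (i : ℤ) (n : ℕ) : Set (ℤ → Letter) :=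
  {w | ∃ s : ℕ, ∀ m < n, w (i + m) = rightSeq p (s + m)}

theorem isClopen_windowSet (p : ℕ) (i : ℤ) (n : ℕ) : IsClopen (windowSet p i n) := by
  have : windowSet p i n = (fun (w : ℤ → Letter) (m : Fin n) => w (i + (m : ℕ))) ⁻¹'
      {f | ∃ s : ℕ, ∀ m, f m = rightSeq p (s + (m : ℕ))} := by
    ext w
    simp only [windowSet, Set.mem_preimage, Set.mem_ofPred_eq, Fin.forall_iff]
  rw [this]
  exact (isClopen_discrete _).preimage (continuous_pi fun m => continuous_apply _)

theorem substSubshift_rho_eq_iInter (p : ℕ) :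
    substSubshift (rho p) = ⋂ (i : ℤ) (n : ℕ), windowSet p i n := by
  ext w
  simp only [mem_substSubshift_rho_iff, Set.mem_iInter, windowSet, Set.mem_ofPred_eq]

theorem substSubshift_subset_windowSet (p : ℕ) (i : ℤ) (n : ℕ) :
    substSubshift (rho p) ⊆ windowSet p i n :=
  fun w hw => (mem_substSubshift_rho_iff p w).1 hw i n

theorem isClosed_substSubshift (p : ℕ) : IsClosed (substSubshift (rho p)) := by
  rw [substSubshift_rho_eq_iInter]
  exact isClosed_iInter fun i => isClosed_iInter fun n => (isClopen_windowSet p i n).isClosed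

theorem closure_orbit_wbar (p : ℕ) (hp : 5 < p) :
    closure (orbit (wbar p)) = substSubshift (rho p) := by
  refine Set.Subset.antisymm (closure_minimal ?_ (isClosed_substSubshift p)) fun w hw => ?_
  · rintro _ ⟨k, rfl⟩
    exact shift_mem_substSubshift (wbar_mem p hp) k
  · choose s hs using fun n : ℕ => (mem_substSubshift_rho_iff p w).1 hw (-n) (2 * n + 1)
    refine mem_closure_of_tendsto (f := fun n : ℕ => shift (s n + n) (wbar p)) (b := Filter.atTop)
      ?_ (Filter.Eventually.of_forall fun n => ⟨_, rfl⟩)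
    rw [tendsto_pi_nhds]
    intro i
    refine tendsto_const_nhds.congr' ?_
    filter_upwards [Filter.eventually_ge_atTop i.natAbs] with n hn
    have := hs n (i + n).toNat (by omega)
    rw [show -(n : ℤ) + (i + n).toNat = i by omega] at this
    rw [this, ← wbar_natCast, shift]
    congr 1; omega

theorem isAlmostPrimitive_rho (p : ℕ) (hp : 5 < p) : IsAlmostPrimitive (rho p) Letter.a where
  ne_nil c := by cases c <;> simp [rho]; omega
  map_fixed := ⟨p, by omega, rfl⟩
  unique_fixed c := by
    rintro ⟨q, -, h⟩
    cases c with
    | a => rfl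
    | b =>
      have : Letter.a ∈ List.replicate q Letter.b := h ▸ by simp [rho]
      exact (List.eq_of_mem_replicate this).symm
  primitive := by
    refine ⟨1, le_rfl, fun c' c hc => ?_⟩
    cases c with
    | a => exact absurd rfl hc
    | b => cases c' <;> simp [substIter, rho]
  legal_pow n := by
    refine ⟨_, constSeq_mem p hp, 0, ?_⟩
    simp [subword, constSeq]

theorem wbar_mem_diff (p : ℕ) (hp : 5 < p) :
    wbar p ∈ substSubshiftEP (rho p) \ {constSeq Letter.a} := by
  refine ⟨⟨wbar_mem p hp, .inr ⟨-1, 1, one_pos, fun n hn => ?_⟩⟩, fun h => ?_⟩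
  · rw [wbar_of_neg p (by omega), wbar_of_neg p (by omega)]
  · have h0 : wbar p (0 : ℕ) = .a := by rw [Set.mem_singleton_iff.1 h]; rfl
    rw [wbar_natCast, rightSeq_zero] at h0
    cases h0

/-! ### Propagation of solutions along words -/

/-- One step of the recursion `ψ (n + 1) = t (w n) * ψ n - ψ (n - 1)` for `(ψ n, ψ (n - 1))`. -/
def solStep {A : Type*} (t : A → ℝ) (v : ℝ × ℝ) (c : A) : ℝ × ℝ := (t c * v.1 - v.2, v.1)

/-- The propagation along the word `u` maps `v` to `v'`, and all intermediate values have norm at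
most `K`. -/
def Carries {A : Type*} (t : A → ℝ) (u : List A) (v v' : ℝ × ℝ) (K : ℝ) : Prop :=
  u.foldl (solStep t) v = v' ∧ ∀ n, ‖(u.take n).foldl (solStep t) v‖ ≤ K

section Carries

variable {A : Type*} {t : A → ℝ} {u u' : List A} {v v' v'' : ℝ × ℝ} {K K' : ℝ}

theorem solStep_smul (s : ℝ) (v : ℝ × ℝ) (c : A) : solStep t (s • v) c = s • solStep t v c := by
  ext
  · simp [solStep]; ring
  · simp [solStep]

theorem foldl_solStep_smul (s : ℝ) (u : List A) (v : ℝ × ℝ) :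
    u.foldl (solStep t) (s • v) = s • u.foldl (solStep t) v := by
  induction u generalizing v with
  | nil => rfl
  | cons c u ih => rw [List.foldl_cons, List.foldl_cons, solStep_smul, ih]

theorem Carries.mono (h : Carries t u v v' K) (hK : K ≤ K') : Carries t u v v' K' :=
  ⟨h.1, fun n => (h.2 n).trans hK⟩

theorem Carries.smul (h : Carries t u v v' K) (s : ℝ) :
    Carries t u (s • v) (s • v') (|s| * K) := by
  refine ⟨by rw [foldl_solStep_smul, h.1], fun n => ?_⟩
  rw [foldl_solStep_smul, norm_smul, Real.norm_eq_abs]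
  exact mul_le_mul_of_nonneg_left (h.2 n) (abs_nonneg s)

theorem Carries.append (h : Carries t u v v' K) (h' : Carries t u' v' v'' K) :
    Carries t (u ++ u') v v'' K := by
  refine ⟨by rw [List.foldl_append, h.1, h'.1], fun n => ?_⟩
  rw [List.take_append]
  rcases le_total n u.length with hn | hn
  · rw [Nat.sub_eq_zero_of_le hn, List.take_zero, List.append_nil]
    exact h.2 n
  · rw [List.foldl_append, List.take_of_length_le hn, h.1]
    exact h'.2 _

theorem exists_carries (t : A → ℝ) (u : List A) (v : ℝ × ℝ) :
    ∃ K, Carries t u v (u.foldl (solStep t) v) K := by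
  induction u generalizing v with
  | nil => exact ⟨‖v‖, rfl, fun n => by simp⟩
  | cons c u ih =>
    obtain ⟨K, hK⟩ := ih (solStep t v c)
    refine ⟨max ‖v‖ K, rfl, fun n => ?_⟩
    cases n with
    | zero => exact le_max_left _ _
    | succ n => exact (hK.2 n).trans (le_max_right _ _)

theorem foldl_solStep_replicate {c : A} {s : ℝ} (h : solStep t v c = s • v) (n : ℕ) :
    (List.replicate n c).foldl (solStep t) v = s ^ n • v := by
  induction n with
  | zero => simp
  | succ n ih => rw [List.replicate_succ, List.foldl_cons, h, foldl_solStep_smul, ih, smul_smul,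
      pow_succ']

theorem carries_replicate {c : A} {s : ℝ} (h : solStep t v c = s • v) (n : ℕ)
    (hK : ∀ m ≤ n, |s| ^ m * ‖v‖ ≤ K) : Carries t (List.replicate n c) v (s ^ n • v) K := by
  refine ⟨foldl_solStep_replicate h n, fun m => ?_⟩
  rw [List.take_replicate, foldl_solStep_replicate h, norm_smul, norm_pow, Real.norm_eq_abs]
  exact hK _ (min_le_right _ _)

end Carries

/-- The exponents in the transfer matrices over the words `ρ ^ (k + 1) (b)`. -/
def gapExponent (p : ℕ) : ℕ → ℕ
  | 0 => 0
  | k + 1 => gapExponent p k + p ^ (k + 1)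

/-- The next gap contracts by at least as much as a block of the present level can amplify. -/
theorem gapExponent_le {p : ℕ} (hp : 2 ≤ p) (k : ℕ) : gapExponent p k ≤ p ^ (k + 1) := by
  induction k with
  | zero => exact Nat.zero_le _
  | succ k ih =>
    rw [gapExponent, pow_succ p (k + 1)]
    nlinarith

theorem pow_le_gapExponent_add_one (p k : ℕ) : p ^ k ≤ gapExponent p k + 1 := by
  cases k with
  | zero => exact le_rfl
  | succ k => rw [gapExponent]; omega

section Blocks

variable {p : ℕ} {t : Letter → ℝ} {l μ K : ℝ} {vu vs : ℝ × ℝ}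

/-- The gap multiplies the contracting vector by μ^n, and the four blocks act as the square of -1.
Inside a block the state may grow by l^e, but e ≤ n, so the size stays below the value μ^e K reached
before the gap. -/
theorem carries_block_tail (hp : 2 ≤ p) (hμ : 0 < μ) (hl : 1 ≤ l) (hlμ : l * μ = 1)
    (hs : solStep t vs .a = μ • vs) (hKs : ‖vs‖ ≤ K) (k : ℕ)
    (hu1 : Carries t (substIter (rho p) (k + 1) .b) vu (μ ^ gapExponent p k • vs) K)
    (hs1 : Carries t (substIter (rho p) (k + 1) .b) vs (-l ^ gapExponent p k • vu)
      (l ^ gapExponent p k * K)) :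
    Carries t (List.replicate (p ^ (k + 1)) .a ++
      (substIter (rho p) (k + 1) .b ++ (substIter (rho p) (k + 1) .b ++
      (substIter (rho p) (k + 1) .b ++ substIter (rho p) (k + 1) .b))))
      (μ ^ gapExponent p k • vs) (μ ^ gapExponent p (k + 1) • vs) (μ ^ gapExponent p k * K) := by
  have hK : 0 ≤ K := (norm_nonneg vs).trans hKs
  have hμ1 : μ ≤ 1 := by nlinarith
  have hE := gapExponent_le hp k
  rw [gapExponent, pow_add μ]
  set e := gapExponent p k
  set n := p ^ (k + 1)
  have hpow : l ^ e * μ ^ e = 1 := by rw [← mul_pow, hlμ, one_pow]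
  have hle : μ ^ n ≤ μ ^ e := pow_le_pow_of_le_one hμ.le hμ1 hE
  have hge := pow_pos hμ e
  have hgn := pow_pos hμ n
  have h0 : Carries t (List.replicate n .a) (μ ^ e • vs) ((μ ^ e * μ ^ n) • vs) (μ ^ e * K) := by
    have := (carries_replicate (K := K) hs n fun m _ => ?_).smul (μ ^ e)
    · rwa [abs_of_pos hge, smul_smul] at this
    · rw [abs_of_pos hμ]
      exact (mul_le_of_le_one_left (norm_nonneg _) (pow_le_one₀ hμ.le hμ1)).trans hKs
  -- The four blocks lead through vs, -vu, -vs, vu and back to vs, up to positive factors; ε is the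
  -- sign on entering a block.
  have hB1 : ∀ ε : ℝ, |ε| = 1 → Carries t (substIter (rho p) (k + 1) .b)
      ((ε * (μ ^ e * μ ^ n)) • vs) ((-ε * μ ^ n) • vu) (μ ^ e * K) := fun ε hε => by
    have := hs1.smul (ε * (μ ^ e * μ ^ n))
    rw [smul_smul, abs_mul, hε, abs_of_pos (by positivity)] at this
    convert this.mono (K' := μ ^ e * K) ?_ using 2
    · linear_combination (ε * μ ^ n) * hpow
    · calc 1 * (μ ^ e * μ ^ n) * (l ^ e * K) = μ ^ n * K * (l ^ e * μ ^ e) := by ring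
        _ ≤ μ ^ e * K := by rw [hpow, mul_one]; exact mul_le_mul_of_nonneg_right hle hK
  have hB2 : ∀ ε : ℝ, |ε| = 1 → Carries t (substIter (rho p) (k + 1) .b)
      ((ε * μ ^ n) • vu) ((ε * (μ ^ e * μ ^ n)) • vs) (μ ^ e * K) := fun ε hε => by
    have := hu1.smul (ε * μ ^ n)
    rw [smul_smul, abs_mul, hε, abs_of_pos hgn] at this
    convert this.mono (K' := μ ^ e * K) ?_ using 2
    · ring
    · rw [one_mul]; exact mul_le_mul_of_nonneg_right hle hK
  have h1 := hB1 1 abs_one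
  have h2 := hB2 (-1) (by simp)
  have h3 := hB1 (-1) (by simp)
  have h4 := hB2 1 abs_one
  simp only [neg_neg, one_mul] at h1 h3 h4
  exact h0.append (h1.append (h2.append (h3.append h4)))

/-- The swap of eigenlines survives each level: four blocks act as the identity and the gap only
rescales, so its length adds to the exponent. The start at level 1 rather than 0 is needed because
it is ρ(b), not b, that swaps the lines. -/
theorem carries_block (hp : 2 ≤ p) (hμ : 0 < μ) (hl : 1 ≤ l) (hlμ : l * μ = 1)
    (hu : solStep t vu .a = l • vu) (hs : solStep t vs .a = μ • vs)
    (hKu : ‖vu‖ ≤ K) (hKs : ‖vs‖ ≤ K)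
    (hu1 : Carries t (substIter (rho p) 1 .b) vu vs K)
    (hs1 : Carries t (substIter (rho p) 1 .b) vs (-vu) K) (k : ℕ) :
    Carries t (substIter (rho p) (k + 1) .b) vu (μ ^ gapExponent p k • vs) K ∧
    Carries t (substIter (rho p) (k + 1) .b) vs (-l ^ gapExponent p k • vu)
      (l ^ gapExponent p k * K) := by
  induction k with
  | zero => simpa [gapExponent] using ⟨hu1, hs1⟩
  | succ k ih =>
    obtain ⟨iu, is⟩ := ih
    have hK : 0 ≤ K := (norm_nonneg vs).trans hKs
    have hμ1 : μ ≤ 1 := by nlinarith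
    rw [substIter_rho_b_succ p (k + 1)]
    constructor
    · refine iu.append ((carries_block_tail hp hμ hl hlμ hs hKs k iu is).mono ?_)
      exact mul_le_of_le_one_left hK (pow_le_one₀ hμ.le hμ1)
    · rw [gapExponent, pow_add l]
      set e := gapExponent p k
      set n := p ^ (k + 1)
      have hl0 : 0 < l := by linarith
      have hpow : l ^ e * μ ^ e = 1 := by rw [← mul_pow, hlμ, one_pow]
      have hge := pow_pos hl0 e
      have hgn := pow_pos hl0 n
      have hn1 : 1 ≤ l ^ n := one_le_pow₀ hl
      have h0 : Carries t (List.replicate n .a) (-l ^ e • vu) (-(l ^ e * l ^ n) • vu)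
          (l ^ e * l ^ n * K) := by
        have := (carries_replicate (K := l ^ n * K) hu n fun m hm => ?_).smul (-l ^ e)
        · rwa [abs_neg, abs_of_pos hge, smul_smul, ← mul_assoc, neg_mul] at this
        · rw [abs_of_pos hl0]
          exact mul_le_mul (pow_le_pow_right₀ hl hm) hKu (norm_nonneg _) hgn.le
      have hB1 : ∀ ε : ℝ, |ε| = 1 → Carries t (substIter (rho p) (k + 1) .b)
          ((ε * l ^ n) • vs) ((-ε * (l ^ e * l ^ n)) • vu) (l ^ e * l ^ n * K) := fun ε hε => by
        have := is.smul (ε * l ^ n)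
        rwa [smul_smul, abs_mul, hε, abs_of_pos hgn,
          show ε * l ^ n * -l ^ e = -ε * (l ^ e * l ^ n) by ring,
          show 1 * l ^ n * (l ^ e * K) = l ^ e * l ^ n * K by ring] at this
      have hB2 : ∀ ε : ℝ, |ε| = 1 → Carries t (substIter (rho p) (k + 1) .b)
          ((ε * (l ^ e * l ^ n)) • vu) ((ε * l ^ n) • vs) (l ^ e * l ^ n * K) := fun ε hε => by
        have := iu.smul (ε * (l ^ e * l ^ n))
        rw [smul_smul, abs_mul, hε, abs_of_pos (mul_pos hge hgn), one_mul] at this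
        convert this using 2
        linear_combination (-ε * l ^ n) * hpow
      have h1 := hB2 (-1) (by simp)
      have h2 := hB1 (-1) (by simp)
      have h3 := hB2 1 abs_one
      have h4 := hB1 1 abs_one
      rw [neg_one_mul] at h1
      rw [neg_neg] at h2
      rw [neg_one_mul] at h4
      refine (is.mono ?_).append (h0.append (h1.append (h2.append (h3.append h4))))
      exact mul_le_mul_of_nonneg_right (le_mul_of_one_le_right hge.le hn1) hK

end Blocks

/-! ### A solution along the right half of `wbar p` -/

/-- The values `(ψ n, ψ (n - 1))` of the solution along `wbar p` starting with `v` at `0`. -/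
def solState (p : ℕ) (t : Letter → ℝ) (v : ℝ × ℝ) : ℕ → ℝ × ℝ
  | 0 => v
  | n + 1 => solStep t (solState p t v n) (rightSeq p n)

theorem solState_eq (p : ℕ) (t : Letter → ℝ) (v : ℝ × ℝ) (k : ℕ) {n : ℕ}
    (hn : n ≤ blockLen p k) :
    solState p t v n = ((substIter (rho p) k .b).take n).foldl (solStep t) v := by
  induction n with
  | zero => rfl
  | succ n ih =>
    rw [solState, ih (by omega), rightSeq_eq p k n hn, List.take_succ_eq_append_getElem hn,
      List.foldl_append, List.foldl_cons, List.foldl_nil]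

theorem norm_solState_le {p : ℕ} {t : Letter → ℝ} {l μ K : ℝ} {vu vs : ℝ × ℝ}
    (hp : 5 < p) (hμ : 0 < μ) (hl : 1 ≤ l) (hlμ : l * μ = 1)
    (hu : solStep t vu .a = l • vu) (hs : solStep t vs .a = μ • vs)
    (hKu : ‖vu‖ ≤ K) (hKs : ‖vs‖ ≤ K)
    (hu1 : Carries t (substIter (rho p) 1 .b) vu vs K)
    (hs1 : Carries t (substIter (rho p) 1 .b) vs (-vu) K) (n : ℕ) :
    ∃ e : ℕ, n ≤ p ^ 2 * (e + 1) ∧ ‖solState p t vu n‖ ≤ μ ^ e * K := by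
  rcases le_or_gt n (blockLen p 1) with hn | hn
  · refine ⟨0, ?_, ?_⟩
    · have := blockLen_le_pow hp 1
      nlinarith
    · rw [solState_eq p t vu 1 hn, pow_zero, one_mul]
      exact hu1.2 n
  · obtain ⟨k, hk1, hk2⟩ : ∃ k, blockLen p (k + 1) < n ∧ n ≤ blockLen p (k + 2) := by
      have hex : ∃ k, n ≤ blockLen p (k + 2) :=
        ⟨n, (lt_blockLen p n).le.trans (blockLen_mono p (by omega))⟩
      refine ⟨Nat.find hex, ?_, Nat.find_spec hex⟩
      rcases h : Nat.find hex with _ | m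
      · exact hn
      · exact not_le.1 (Nat.find_min hex (m := m) (by omega))
    obtain ⟨iu, is⟩ := carries_block (by omega) hμ hl hlμ hu hs hKu hKs hu1 hs1 k
    have ht := carries_block_tail (by omega) hμ hl hlμ hs hKs k iu is
    refine ⟨gapExponent p k, ?_, ?_⟩
    · calc n ≤ p ^ (k + 2) := hk2.trans (blockLen_le_pow hp _)
        _ = p ^ 2 * p ^ k := by ring
        _ ≤ _ := Nat.mul_le_mul_left _ (pow_le_gapExponent_add_one p k)
    · rw [solState_eq p t vu (k + 2) hk2, substIter_rho_b_succ p (k + 1), List.take_append,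
        List.take_of_length_le hk1.le, List.foldl_append, iu.1]
      exact ht.2 _

/-! ### The eigenvector -/

/-- Values `t .a`, `t .b` for which the transfer matrix over `ρ (b)` is the trace-free map
`(v₁, v₂) ↦ (m * v₁ + n * v₂, r * v₁ - m * v₂)`, of square `-1`, that exchanges the two eigenlines
of the hyperbolic transfer matrix of the letter `a`. -/
theorem exists_hopping_values : ∃ (t : Letter → ℝ) (κ m n r : ℝ), Function.Injective t ∧ 0 < κ ∧
    Real.exp κ + Real.exp (-κ) = t .a ∧ m ^ 2 + n * r = -1 ∧ r = n + m * t .a ∧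
    ∀ p v, (substIter (rho p) 1 .b).foldl (solStep t) v =
      (m * v.1 + n * v.2, r * v.1 - m * v.2) := by
  -- Let A and B be the transfer matrices of a and b, with traces x and y. Here s = y² - 2 is the
  -- trace of B² and q = xy - 2 that of AB. The trace of M = B⁴AB is (s² - 1)q - 2s; setting it to
  -- zero gives q. Since det M = 1, M then swaps the eigenlines of A as soon as tr(MA) = 0, that is
  -- r = n + m x. Eliminating q turns this into the sextic; the interval for s ensures x > 2 > y.
  obtain ⟨s, ⟨hs1, hs2⟩, hs⟩ : (0 : ℝ) ∈
      (fun s : ℝ => s ^ 6 + s ^ 5 - 4 * s ^ 4 - 2 * s ^ 3 + 5 * s ^ 2 - 3 * s - 2) ''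
        Set.Icc 1.6 1.65 :=
    intermediate_value_Icc (by norm_num) (by fun_prop) ⟨by norm_num, by norm_num⟩
  simp only at hs
  have hD : 0 < s ^ 2 - 1 := by nlinarith
  set q : ℝ := 2 * s / (s ^ 2 - 1)
  have hq : q * (s ^ 2 - 1) = 2 * s := div_mul_cancel₀ _ hD.ne'
  have hq1 : 1.9 ≤ q := by rw [le_div_iff₀ hD]; nlinarith
  set y : ℝ := √(s + 2)
  have hy2 : y ^ 2 = s + 2 := Real.sq_sqrt (by linarith)
  have hy0 : 0 < y := Real.sqrt_pos.2 (by linarith)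
  have hy : y < 1.92 := by nlinarith
  set x : ℝ := (q + 2) / y
  have hxy : x * y = q + 2 := div_mul_cancel₀ _ hy0.ne'
  have hx : 2 < x := by rw [lt_div_iff₀ hy0]; linarith
  clear_value q y x
  -- This is the equation r = n + m x multiplied by y, with x and y eliminated.
  have hquad : 2 * s ^ 2 * q - s * q ^ 2 + s ^ 2 - 3 * s - 2 = 0 := by
    have : (s ^ 2 - 1) ^ 2 * (2 * s ^ 2 * q - s * q ^ 2 + s ^ 2 - 3 * s - 2) = 0 := by
      linear_combination hs + (2 * s ^ 2 * (s ^ 2 - 1) - s * q * (s ^ 2 - 1) - 2 * s ^ 2) * hq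
    exact (mul_eq_zero.1 this).resolve_left (by positivity)
  refine ⟨fun c => match c with | .a => x | .b => y, Real.arcosh (x / 2), s * q + s - 1,
    y * s - (s ^ 2 + s - 1) * x, y * (s * q - 1), ?_, ?_, ?_, ?_, ?_, ?_⟩
  · have hne : x ≠ y := by linarith
    intro c c' h
    cases c <;> cases c' <;> first | rfl | exact absurd h hne | exact absurd h hne.symm
  · exact Real.arcosh_pos (by linarith)
  · have := Real.cosh_arcosh (x := x / 2) (by linarith)
    rw [Real.cosh_eq] at this
    show _ = x
    linear_combination 2 * this
  · linear_combination (s * (s * q - 1)) * hy2 - ((s ^ 2 + s - 1) * (s * q - 1)) * hxy -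
      (s * q - 1 + s) * hq
  · show _ = _ + (s * q + s - 1) * x
    refine mul_left_cancel₀ hy0.ne' ?_
    linear_combination (s * q - 1 - s) * hy2 - (s * q - s ^ 2) * hxy + hquad
  · intro p v
    ext
    · simp only [solStep, substIter, rho, Function.iterate_one, List.flatMap_singleton,
        List.foldl_cons, List.foldl_nil]
      linear_combination ((y ^ 2 + s - 1) * (x * (y * v.1 - v.2) - v.1) - y * (y * v.1 - v.2) -
        s * v.1) * hy2 + (s ^ 2 + s - 1) * v.1 * hxy + v.1 * hq
    · simp only [solStep, substIter, rho, Function.iterate_one, List.flatMap_singleton,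
        List.foldl_cons, List.foldl_nil]
      linear_combination (y * (x * (y * v.1 - v.2) - v.1) - (y * v.1 - v.2)) * hy2 +
        (y * s * v.1 - s * v.2) * hxy

theorem memlp_of_exp_decay {f : ℤ → ℂ} {C γ : ℝ} (hγ : 0 < γ)
    (h : ∀ n : ℤ, ‖f n‖ ≤ C * Real.exp (-γ * |(n : ℝ)|)) : Memℓp f 2 := by
  refine memℓp_gen ?_
  have hC : 0 ≤ C := by simpa using (norm_nonneg _).trans (h 0)
  have hs : Summable fun n : ℤ => C ^ 2 * Real.exp (-(2 * γ) * |(n : ℝ)|) := by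
    refine Summable.mul_left _ (Summable.of_nat_of_neg ?_ ?_) <;>
    · simp only [Int.cast_neg, Int.cast_natCast, abs_neg, Nat.abs_cast]
      simp_rw [mul_comm (-(2 * γ))]
      exact Real.summable_exp_nat_mul_iff.2 (by linarith)
  refine hs.of_nonneg_of_le (fun n => by positivity) fun n => ?_
  simp only [ENNReal.toReal_ofNat, Real.rpow_ofNat]
  calc ‖f n‖ ^ 2 ≤ (C * Real.exp (-γ * |(n : ℝ)|)) ^ 2 :=
        pow_le_pow_left₀ (norm_nonneg _) (h n) 2
    _ = _ := by rw [mul_pow, ← Real.exp_nat_mul]; congr 2; push_cast; ring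

theorem isEigenvector_iff {A : Type*} [Fintype A] (V : A → ℝ) (w : ℤ → A) (E : ℂ) (ψ : L2Z) :
    IsEigenvector (schrodinger V w) E ψ ↔
      (∀ n, ψ (n - 1) + ψ (n + 1) + (V (w n) : ℂ) * ψ n = E * ψ n) ∧ ψ ≠ 0 := by
  rw [IsEigenvector, Module.End.hasEigenvector_iff, Module.End.mem_eigenspace_iff]
  refine and_congr_left fun _ => ?_
  simp only [← schrodinger_apply]
  constructor
  · intro h n
    have := congrArg (fun φ : L2Z => φ n) h
    simpa using this
  · intro h
    refine lp.ext (funext fun n => ?_)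
    simpa using h n

theorem exists_eigenvector_wbar (p : ℕ) (hp : 5 < p) : ∃ V : Letter → ℝ, Function.Injective V ∧
    ∃ (E : ℝ) (ψ : L2Z),
      IsEigenvector (schrodinger V (wbar p)) E ψ ∧ ExponentiallyDecaying ψ := by
  obtain ⟨t, κ, m, n, r, hinj, hκ, hx, hdet, hr, hM⟩ := exists_hopping_values
  refine ⟨fun c => -t c, neg_injective.comp hinj, 0, ?_⟩
  set l := Real.exp κ
  set μ := Real.exp (-κ)
  have hμ : 0 < μ := Real.exp_pos _
  have hl : 1 ≤ l := Real.one_le_exp hκ.le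
  have hlμ : l * μ = 1 := by rw [← Real.exp_add, add_neg_cancel, Real.exp_zero]
  set vu : ℝ × ℝ := (l, 1)
  have hu : solStep t vu .a = l • vu := by
    ext
    · simp only [solStep, vu, Prod.smul_fst, smul_eq_mul]
      linear_combination -l * hx + hlμ
    · simp [solStep, vu]
  set vs : ℝ × ℝ := (substIter (rho p) 1 .b).foldl (solStep t) vu with hvs
  have hs : solStep t vs .a = μ • vs := by
    rw [hvs, hM]
    -- The second coordinate of M vu is l times the first, which puts M vu on the contracting
    -- eigenline.
    have h12 : r * l - m = l * (m * l + n) := by linear_combination l * hr - m * l * hx + m * hlμ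
    ext
    · simp only [solStep, vu, Prod.smul_fst, smul_eq_mul, mul_one]
      linear_combination -(m * l + n) * hx - h12
    · simp only [solStep, vu, Prod.smul_snd, smul_eq_mul, mul_one]
      linear_combination -(m * l + n) * hlμ - μ * h12
  have hsu : (substIter (rho p) 1 .b).foldl (solStep t) vs = -vu := by
    rw [hvs, hM, hM]
    ext
    · simp only [vu, Prod.fst_neg]
      linear_combination l * hdet
    · simp only [vu, Prod.snd_neg]
      linear_combination hdet
  obtain ⟨K₁, hK₁⟩ := exists_carries t (substIter (rho p) 1 .b) vu
  obtain ⟨K₂, hK₂⟩ := exists_carries t (substIter (rho p) 1 .b) vs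
  rw [hsu] at hK₂
  rw [← hvs] at hK₁
  have hbound := norm_solState_le hp hμ hl hlμ hu hs
    ((hK₁.2 0).trans (le_max_left K₁ K₂)) ((hK₂.2 0).trans (le_max_right K₁ K₂))
    (hK₁.mono (le_max_left K₁ K₂)) (hK₂.mono (le_max_right K₁ K₂))
  set K := max K₁ K₂
  have hKl : l ≤ K := by
    refine le_trans ?_ ((hK₁.2 0).trans (le_max_left K₁ K₂))
    exact (le_abs_self l).trans (norm_fst_le vu)
  have hK : 0 < K := by linarith
  -- On the left the solution is the pure exponential whose state at the origin is (e^κ, 1) = `vu`;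
  -- the same formula still gives the value at 0.
  set f : ℤ → ℝ := fun n => if n < 0 then Real.exp (κ * (n + 1)) else (solState p t vu n.toNat).1
  have hfneg : ∀ n : ℤ, n ≤ 0 → f n = Real.exp (κ * (n + 1)) := by
    intro n hn
    rcases hn.lt_or_eq with h | rfl
    · exact if_pos h
    · simp [f, solState, vu, l]
  have hfpos : ∀ n : ℕ, f n = (solState p t vu n).1 := fun n => by simp [f]
  have hfsnd : ∀ n : ℕ, f (n - 1) = (solState p t vu n).2 := by
    intro n
    cases n with
    | zero => simp [f, solState, vu]
    | succ n =>
      rw [Nat.cast_succ, add_sub_cancel_right, hfpos]; rfl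
  have hrec : ∀ n : ℤ, f (n - 1) + f (n + 1) = t (wbar p n) * f n := by
    intro n
    rcases lt_or_ge n 0 with hn | hn
    · rw [hfneg _ (by omega), hfneg _ (by omega), hfneg _ hn.le, wbar_of_neg p hn, ← hx]
      simp only [l, μ, add_mul, ← Real.exp_add]
      rw [add_comm]
      congr 2 <;> push_cast <;> ring
    · lift n to ℕ using hn
      rw [hfsnd, hfpos, ← Nat.cast_succ, hfpos, solState, solStep, wbar_natCast]
      ring
  -- The rate comes from n ≤ p²(e + 1); the factor l in the constant below absorbs the extra 1.
  set γ := κ / p ^ 2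
  have hγ : 0 < γ := by positivity
  have hγκ : γ ≤ κ := div_le_self hκ.le (one_le_pow₀ (by exact_mod_cast (by omega : 1 ≤ p)))
  have hdecay : ∀ n : ℤ, |f n| ≤ K * l * Real.exp (-γ * |(n : ℝ)|) := by
    intro n
    rcases le_or_gt n 0 with hn | hn
    · have hn' : (n : ℝ) ≤ 0 := by exact_mod_cast hn
      rw [hfneg n hn, abs_of_pos (Real.exp_pos _), abs_of_nonpos hn', mul_add, mul_one,
        Real.exp_add, mul_comm]
      refine mul_le_mul ?_ (Real.exp_le_exp.2 (by nlinarith)) (Real.exp_pos _).le (by positivity)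
      exact le_mul_of_one_le_left (by positivity) (hl.trans hKl)
    · lift n to ℕ using hn.le
      obtain ⟨e, he, hle⟩ := hbound n
      rw [hfpos, Int.cast_natCast, Nat.abs_cast]
      refine ((norm_fst_le _).trans hle).trans ?_
      rw [mul_comm, mul_assoc, ← Real.exp_nat_mul, ← Real.exp_add]
      refine mul_le_mul_of_nonneg_left (Real.exp_le_exp.2 ?_) hK.le
      have he' : (n : ℝ) ≤ p ^ 2 * (e + 1) := by exact_mod_cast he
      have hp0 : (0 : ℝ) < p ^ 2 := by positivity
      have : γ * n ≤ κ * (e + 1) := by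
        rw [div_mul_eq_mul_div, div_le_iff₀ hp0]
        nlinarith
      linarith
  have hdecay' : ∀ n : ℤ, ‖(f n : ℂ)‖ ≤ K * l * Real.exp (-γ * |(n : ℝ)|) := fun n => by
    rw [Complex.norm_real]; exact hdecay n
  refine ⟨⟨fun n => (f n : ℂ), memlp_of_exp_decay hγ hdecay'⟩, ?_, K * l, γ, by positivity, hγ,
    hdecay'⟩
  rw [isEigenvector_iff]
  constructor
  · intro n
    have := congrArg (Complex.ofReal) (hrec n)
    push_cast at this ⊢
    rw [this]; ring
  · intro h
    have := congrArg (fun φ : L2Z => φ 0) h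
    have h0 : (f 0 : ℂ) = 0 := this
    rw [Complex.ofReal_eq_zero, hfneg 0 le_rfl] at h0
    exact (Real.exp_pos _).ne' h0

theorem exists_eigenvector_shift {A : Type*} [Fintype A] (V : A → ℝ) {w : ℤ → A} {E : ℂ} {ψ : L2Z}
    (h : IsEigenvector (schrodinger V w) E ψ) (k : ℤ) :
    IsEigenvector (schrodinger V (shift k w)) E (translateL2 k ψ) := by
  rw [isEigenvector_iff] at h ⊢
  refine ⟨fun n => ?_, fun h0 => h.2 (lp.ext (funext fun n => ?_))⟩
  · have := h.1 (n + k)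
    simp only [translateL2_apply, shift]
    rw [← this]
    congr 3 <;> exact congrArg ψ (by ring)
  · have := congrArg (fun φ : L2Z => φ (n - k)) h0
    simpa [translateL2_apply] using this

theorem ExponentiallyDecaying.translate {ψ : L2Z} (h : ExponentiallyDecaying ψ) (k : ℤ) :
    ExponentiallyDecaying (translateL2 k ψ) := by
  obtain ⟨C, γ, hC, hγ, h⟩ := h
  refine ⟨C * Real.exp (γ * |(k : ℝ)|), γ, by positivity, hγ, fun n => (h (n + k)).trans ?_⟩
  rw [mul_assoc, ← Real.exp_add]
  refine mul_le_mul_of_nonneg_left (Real.exp_le_exp.2 ?_) hC.le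
  have := abs_sub (((n + k : ℤ)) : ℝ) k
  push_cast at this ⊢
  rw [add_sub_cancel_right] at this
  nlinarith

/-! ### Absence of eigenvalues for locally repetitive potentials -/

/-- The coefficients depend only on the potential values, so repeated words share one matrix of
determinant 1. -/
theorem exists_transfer_coeffs (v : ℕ → ℂ) (n : ℕ) : ∃ a b c d : ℂ, a * d - b * c = 1 ∧
    ∀ (f : ℤ → ℂ) (i : ℤ), (∀ j < n, f (i + j + 1) = v j * f (i + j) - f (i + j - 1)) →
      f (i + n) = a * f i + b * f (i - 1) ∧ f (i + n - 1) = c * f i + d * f (i - 1) := by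
  induction n with
  | zero => exact ⟨1, 0, 0, 1, by norm_num, fun f i _ => by simp⟩
  | succ n ih =>
    obtain ⟨a, b, c, d, hdet, h⟩ := ih
    refine ⟨v n * a - c, v n * b - d, a, b, by linear_combination hdet, fun f i hf => ?_⟩
    obtain ⟨h1, h2⟩ := h f i fun j hj => hf j (by omega)
    have h3 := hf n (by omega)
    rw [h1, h2] at h3
    push_cast
    rw [← add_assoc, h3, add_sub_cancel_right, h1]
    exact ⟨by ring, rfl⟩

/-- On `[-q, 2 * q)` the sequence `w` is a threefold repetition of a word of length `q`. -/
def RepeatsThrice {A : Type*} (w : ℤ → A) (q : ℕ) : Prop :=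
  ∀ i : ℤ, -q ≤ i → i < q → w (i + q) = w i

/-- Gordon's argument. Cayley–Hamilton for the matrix of one period, with trace t, gives f(2q) +
f(0) = t f(q) and f(q) + f(-q) = t f(0). If |t| ≥ 1 the second identity bounds f(0), otherwise the
first does. -/
theorem RepeatsThrice.norm_le {w : ℤ → ℂ} {f : ℤ → ℂ} {q : ℕ} (hw : RepeatsThrice w q)
    (hf : ∀ n, f (n + 1) = w n * f n - f (n - 1)) :
    ‖f 0‖ ≤ ‖f q‖ + ‖f (-q)‖ + ‖f (2 * q)‖ ∧
      ‖f (-1)‖ ≤ ‖f (q - 1)‖ + ‖f (-q - 1)‖ + ‖f (2 * q - 1)‖ := by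
  obtain ⟨a, b, c, d, hdet, h⟩ := exists_transfer_coeffs (fun j => w j) q
  obtain ⟨h1, h2⟩ := h f (-q) fun j hj => by
    rw [hf]; congr 2
    rw [← hw (-q + j) (by omega) (by omega)]; congr 1; omega
  obtain ⟨h3, h4⟩ := h f 0 fun j hj => by rw [hf]; simp
  obtain ⟨h5, h6⟩ := h f q fun j hj => by
    rw [hf]; congr 2
    rw [← hw j (by omega) (by omega)]; congr 1; omega
  rw [neg_add_cancel] at h1 h2
  rw [zero_add] at h3 h4
  rw [← two_mul] at h5 h6
  rw [zero_sub] at h2 h3 h4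
  have aux : ∀ t x y z u : ℂ, u + x = t * z → z + y = t * x → ‖x‖ ≤ ‖z‖ + ‖y‖ + ‖u‖ := by
    intro t x y z u e1 e2
    rcases le_total 1 ‖t‖ with ht | ht
    · have : ‖x‖ ≤ ‖z + y‖ := by
        rw [e2, norm_mul]; exact le_mul_of_one_le_left (norm_nonneg _) ht
      linarith [norm_add_le z y, norm_nonneg u]
    · have h7 : ‖t * z‖ ≤ ‖z‖ := by
        rw [norm_mul]; exact mul_le_of_le_one_left (norm_nonneg _) ht
      have h8 : x = t * z - u := by rw [← e1]; ring
      have h9 := norm_sub_le (t * z) u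
      rw [← h8] at h9
      linarith [norm_nonneg y]
  constructor
  · refine aux (a + d) _ _ _ _ ?_ ?_
    · linear_combination h5 - d * h3 + b * h4 - f 0 * hdet
    · linear_combination h3 - d * h1 + b * h2 - f (-q) * hdet
  · refine aux (a + d) _ _ _ _ ?_ ?_
    · linear_combination h6 - a * h4 + c * h3 - f (-1) * hdet
    · linear_combination h4 - a * h2 + c * h1 - f (-q - 1) * hdet

theorem L2Z.tendsto_zero (ψ : L2Z) : Filter.Tendsto (fun n => ‖ψ n‖) Filter.cofinite (nhds 0) := by
  have h := ((memℓp_gen_iff (p := 2) (by norm_num)).1 (lp.memℓp ψ)).tendsto_cofinite_zero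
  simp only [ENNReal.toReal_ofNat, Real.rpow_ofNat] at h
  have := h.sqrt
  simpa [Real.sqrt_sq] using this

/-- An ℓ² solution tends to zero at ±q and 2q, so the three-block bound along infinitely many q
forces ψ(0) = ψ(-1) = 0, and the recursion spreads this to all of ℤ. -/
theorem not_isEigenvector_of_frequently_repeatsThrice {A : Type*} [Fintype A] (V : A → ℝ)
    {w : ℤ → A} (hw : ∃ᶠ q in Filter.atTop, RepeatsThrice w q) (E : ℂ) (ψ : L2Z) :
    ¬ IsEigenvector (schrodinger V w) E ψ := by
  rw [isEigenvector_iff]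
  rintro ⟨h, hne⟩
  have hrec : ∀ n, ψ (n + 1) = (E - V (w n)) * ψ n - ψ (n - 1) := fun n => by
    linear_combination h n
  have hlim : ∀ g : ℕ → ℤ, Function.Injective g →
      Filter.Tendsto (fun q => ‖ψ (g q)‖) Filter.atTop (nhds 0) := fun g hg => by
    rw [← Nat.cofinite_eq_atTop]
    exact ψ.tendsto_zero.comp hg.tendsto_cofinite
  have hzero : ∀ (x : ℂ) (g₁ g₂ g₃ : ℕ → ℤ), Function.Injective g₁ → Function.Injective g₂ →
      Function.Injective g₃ →
      (∀ q, RepeatsThrice w q → ‖x‖ ≤ ‖ψ (g₁ q)‖ + ‖ψ (g₂ q)‖ + ‖ψ (g₃ q)‖) → x = 0 := by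
    intro x g₁ g₂ g₃ h₁ h₂ h₃ hx
    by_contra hx0
    have hsum := ((hlim g₁ h₁).add (hlim g₂ h₂)).add (hlim g₃ h₃)
    rw [add_zero, add_zero] at hsum
    obtain ⟨q, hq, hlt⟩ :=
      (hw.and_eventually (hsum.eventually_lt_const (norm_pos_iff.2 hx0))).exists
    exact absurd (hx q hq) (not_le.2 hlt)
  have hper : ∀ q, RepeatsThrice w q → RepeatsThrice (fun n => E - (V (w n) : ℂ)) q :=
    fun q hq i h1 h2 => by simp only [hq i h1 h2]
  have h0 : ψ 0 = 0 := hzero _ (fun q => q) (fun q => -q) (fun q => 2 * q)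
    (fun _ _ => by simp) (fun _ _ => by simp) (fun _ _ => by simp)
    fun q hq => ((hper q hq).norm_le hrec).1
  have h1 : ψ (-1) = 0 := hzero _ (fun q => q - 1) (fun q => -q - 1) (fun q => 2 * q - 1)
    (fun _ _ => by simp) (fun _ _ => by simp) (fun _ _ => by simp)
    fun q hq => ((hper q hq).norm_le hrec).2
  have hall : ∀ n : ℤ, ψ n = 0 ∧ ψ (n - 1) = 0 := by
    intro n
    induction n using Int.induction_on with
    | zero => exact ⟨h0, h1⟩
    | succ n ih => exact ⟨by rw [hrec, ih.1, ih.2]; simp, by simpa using ih.1⟩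
    | pred n ih =>
      refine ⟨ih.2, ?_⟩
      have := hrec (-n - 1)
      rw [sub_add_cancel, ih.1, ih.2] at this
      simpa using this.symm
  exact hne (lp.ext (funext fun n => (hall n).1))

theorem purePointSpectrum_eq_empty {A : Type*} [Fintype A] (V : A → ℝ) {w : ℤ → A}
    (hw : ∃ j : ℤ, ∃ᶠ q in Filter.atTop, RepeatsThrice (shift j w) q) :
    purePointSpectrum (schrodinger V w) = ∅ := by
  obtain ⟨j, hj⟩ := hw
  rw [purePointSpectrum, closure_empty_iff, Set.eq_empty_iff_forall_notMem]
  intro E hE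
  obtain ⟨ψ, hψ⟩ := Module.End.HasEigenvalue.exists_hasEigenvector hE
  exact not_isEigenvector_of_frequently_repeatsThrice V hj E _ (exists_eigenvector_shift V hψ j)

/-! ### Invariant measures -/

open MeasureTheory

instance : DiscreteMeasurableSpace Letter := ⟨fun _ => MeasurableSpace.measurableSet_top⟩

theorem measurable_shift {A : Type*} [MeasurableSpace A] (k : ℤ) :
    Measurable (shift k : (ℤ → A) → ℤ → A) :=
  measurable_pi_lambda _ fun _ => measurable_pi_apply _

theorem shift_shift {A : Type*} (j k : ℤ) (w : ℤ → A) : shift j (shift k w) = shift (j + k) w :=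
  funext fun n => congrArg w (by ring)

theorem measurePreserving_shift_natCast {A : Type*} [MeasurableSpace A] {ν : Measure (ℤ → A)}
    (h : MeasurePreserving (shift 1) ν ν) (n : ℕ) : MeasurePreserving (shift (n : ℤ)) ν ν := by
  convert h.iterate n using 1
  induction n with
  | zero => exact funext fun w => funext fun i => congrArg w (by simp)
  | succ n ih =>
    rw [Function.iterate_succ, ← ih]
    funext w
    rw [Function.comp_apply, shift_shift, Nat.cast_succ]

theorem measure_preimage_shift {A : Type*} [MeasurableSpace A] {ν : Measure (ℤ → A)}
    (h : MeasurePreserving (shift 1) ν ν) (k : ℤ) {S : Set (ℤ → A)} (hS : MeasurableSet S) :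
    ν (shift k ⁻¹' S) = ν S := by
  rcases Int.eq_nat_or_neg k with ⟨n, rfl | rfl⟩
  · exact (measurePreserving_shift_natCast h n).measure_preimage hS.nullMeasurableSet
  · have := (measurePreserving_shift_natCast h n).measure_preimage
      ((measurable_shift (-n : ℤ) hS).nullMeasurableSet)
    rw [← this, ← Set.preimage_comp]
    congr 1
    ext w
    simp only [Set.mem_preimage, Function.comp_apply, shift_shift, neg_add_cancel]
    rw [show shift 0 w = w from funext fun i => congrArg w (add_zero i)]

/-- The sequences with the letter `b` at position `0`. -/
def cylinderB : Set (ℤ → Letter) := {w | w 0 = .b}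

theorem measurableSet_apply_eq (i : ℤ) (c : Letter) : MeasurableSet {w : ℤ → Letter | w i = c} :=
  (measurable_pi_apply (X := fun _ => Letter) i) (MeasurableSet.of_discrete (s := {c}))

theorem measurableSet_cylinderB : MeasurableSet cylinderB := measurableSet_apply_eq 0 .b

theorem measurableSet_repeatsThrice (q : ℕ) :
    MeasurableSet {w : ℤ → Letter | RepeatsThrice w q} := by
  simp only [RepeatsThrice, Set.ofPred_forall]
  exact .iInter fun i => .iInter fun _ => .iInter fun _ =>
    measurableSet_eq_fun (measurable_pi_apply _) (measurable_pi_apply _)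

theorem measurableSet_blockAt (p k : ℕ) (i : ℤ) : MeasurableSet {w | BlockAt p k w i} := by
  simp only [BlockAt, Set.ofPred_forall]
  exact .iInter fun m => .iInter fun _ => measurableSet_apply_eq _ _

theorem measure_blockAt {ν : Measure (ℤ → Letter)} (h : MeasurePreserving (shift 1) ν ν)
    (p k : ℕ) (i : ℤ) : ν {w | BlockAt p k w i} = ν {w | BlockAt p k w 0} := by
  rw [← measure_preimage_shift h i (measurableSet_blockAt p k 0)]
  congr 1
  ext w
  simp only [Set.mem_preimage, Set.mem_ofPred_eq, BlockAt, shift, zero_add, add_comm i]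

/-- Otherwise the last b of the initial B_k in the later occurrence would fall into the gap of the
earlier one, which is at least L_k long. -/
theorem not_blockAt_of_lt {p k : ℕ} (hp : 5 < p) {w : ℤ → Letter} {i i' : ℤ}
    (h : BlockAt p (k + 1) w i) (h' : BlockAt p (k + 1) w i') (hlt : i < i') :
    i + blockLen p k ≤ i' := by
  by_contra! hc
  have hL := blockLen_le_pow hp k
  have hs := blockLen_succ p k
  have h1 := h (blockLen p k + (i' - i - 1).toNat) (by omega)
  rw [rightSeq_gap p k (by omega)] at h1
  have h2 := h' (blockLen p k - 1) (by omega)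
  rw [rightSeq_last, show i' + ((blockLen p k - 1 : ℕ) : ℤ) =
    i + ((blockLen p k + (i' - i - 1).toNat : ℕ) : ℤ) by omega, h1] at h2
  cases h2

/-- The positions of the letter `b` in `ρ ^ k (b)`. -/
def positionsB (p k : ℕ) : Finset ℕ := (Finset.range (blockLen p k)).filter (rightSeq p · = .b)

/-- The sequences whose position `0` carries the letter `b` of a copy of `ρ ^ k (b)`
starting at position `o` of an occurrence of `ρ ^ (k + 1) (b)`. -/
def copySet (p k o : ℕ) : Set (ℤ → Letter) :=
  ⋃ j ∈ positionsB p k, {w | BlockAt p (k + 1) w (-(o + j : ℕ))}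

theorem measure_copySet_le {ν : Measure (ℤ → Letter)} (h : MeasurePreserving (shift 1) ν ν)
    (p k o : ℕ) :
    ν (copySet p k o) ≤ (positionsB p k).card * ν {w | BlockAt p (k + 1) w 0} := by
  refine (measure_biUnion_finset_le _ _).trans_eq ?_
  simp only [measure_blockAt h, Finset.sum_const, nsmul_eq_mul]

/-- Equality holds because the offsets j differ by less than L_k, while distinct occurrences of
B_{k+1} are at least L_k apart; the union is therefore disjoint. -/
theorem measure_copySet {ν : Measure (ℤ → Letter)} (h : MeasurePreserving (shift 1) ν ν)
    {p : ℕ} (hp : 5 < p) (k o : ℕ) :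
    ν (copySet p k o) = (positionsB p k).card * ν {w | BlockAt p (k + 1) w 0} := by
  rw [copySet, measure_biUnion_finset]
  · simp only [measure_blockAt h, Finset.sum_const, nsmul_eq_mul]
  · intro j hj j' hj' hne
    simp only [positionsB, Finset.coe_filter, Finset.mem_range, Set.mem_ofPred_eq] at hj hj'
    refine Set.disjoint_left.2 fun w h1 h2 => ?_
    rcases hne.lt_or_gt with hlt | hlt
    · have := not_blockAt_of_lt hp h2 h1 (by omega)
      omega
    · have := not_blockAt_of_lt hp h1 h2 (by omega)
      omega
  · exact fun j _ => measurableSet_blockAt _ _ _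

theorem rightSeq_add_blockLen (p k : ℕ) {m : ℕ} (h1 : blockLen p k + p ^ k ≤ m)
    (h2 : m < blockLen p k + p ^ k + 3 * blockLen p k) :
    rightSeq p (m + blockLen p k) = rightSeq p m := by
  obtain ⟨r, rfl⟩ := Nat.exists_eq_add_of_le h1
  have hL := blockLen_pos p k
  have hmod := Nat.mod_lt r hL
  have hdiv : r / blockLen p k < 3 := by rw [Nat.div_lt_iff_lt_mul hL]; omega
  rw [← Nat.div_add_mod' r (blockLen p k), ← add_assoc (blockLen p k + p ^ k),
    rightSeq_copy p k (by omega) hmod, ← rightSeq_copy p k (d := r / blockLen p k + 1)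
    (by omega) hmod]
  congr 1; ring

/-- The second copy in B_k^4 has one copy before it and two after, so the window [-L_k, 2 L_k)
around any of its positions stays inside the power. -/
theorem copySet_subset (p k : ℕ) : copySet p k (blockLen p k + p ^ k + 1 * blockLen p k) ⊆
    cylinderB ∩ {w | RepeatsThrice w (blockLen p k)} := by
  intro w hw
  simp only [copySet, positionsB, Set.mem_iUnion, Finset.mem_filter, Finset.mem_range,
    Set.mem_ofPred_eq, exists_prop] at hw
  obtain ⟨j, ⟨hj, hjb⟩, hw⟩ := hw
  have hs := blockLen_succ p k
  have key : ∀ (x : ℤ) (m : ℕ), x + (blockLen p k + p ^ k + 1 * blockLen p k + j : ℕ) = m →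
      m < blockLen p (k + 1) → w x = rightSeq p m := fun x m hx hm => by
    rw [← hw m hm]; congr 1; omega
  refine ⟨?_, fun x hx1 hx2 => ?_⟩
  · show w 0 = .b
    rw [key 0 _ (zero_add _) (by omega), rightSeq_copy p k (by omega) hj, hjb]
  · obtain ⟨m, hm⟩ : ∃ m : ℕ, x + (blockLen p k + p ^ k + 1 * blockLen p k + j : ℕ) = m :=
      ⟨(x + (blockLen p k + p ^ k + 1 * blockLen p k + j : ℕ)).toNat, by omega⟩
    rw [key x m hm (by omega), key _ (m + blockLen p k) (by omega) (by omega),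
      rightSeq_add_blockLen p k (by omega) (by omega)]

/-- Five copies of B_k exhaust the b's in B_{k+1}; each contributes at most c, and the second member
of B_k^4 contributes exactly c to the repetitive part. -/
theorem measure_cylinderB_le {p : ℕ} (hp : 5 < p) {ν : Measure (ℤ → Letter)}
    (h : MeasurePreserving (shift 1) ν ν) (hX : ν (substSubshift (rho p))ᶜ = 0) (k : ℕ) :
    ν cylinderB ≤ 5 * ν (cylinderB ∩ {w | RepeatsThrice w (blockLen p k)}) := by
  have hsub : cylinderB ⊆ (substSubshift (rho p))ᶜ ∪ (copySet p k 0 ∪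
      ⋃ d ∈ Finset.range 4, copySet p k (blockLen p k + p ^ k + d * blockLen p k)) := by
    intro w hw
    by_cases hwX : w ∈ substSubshift (rho p)
    · obtain ⟨s, hs, hsb, hblock⟩ := exists_blockAt hwX hw (k + 1)
      rw [zero_sub] at hblock
      obtain ⟨j, hj, hjb, rfl | ⟨d, hd, rfl⟩⟩ := exists_copy_of_rightSeq_eq_b p k hs hsb
      · refine .inr (.inl (Set.mem_biUnion (x := s) (by simp [positionsB, hj, hjb]) ?_))
        simpa using hblock
      · exact .inr (.inr (Set.mem_biUnion (x := d) (by simpa using hd)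
          (Set.mem_biUnion (x := j) (by simp [positionsB, hj, hjb]) hblock)))
    · exact .inl hwX
  set c := ((positionsB p k).card : ℝ≥0∞) * ν {w | BlockAt p (k + 1) w 0}
  calc ν cylinderB ≤ 0 + (c + ∑ d ∈ Finset.range 4, c) := by
        refine (measure_mono hsub).trans ((measure_union_le _ _).trans ?_)
        refine add_le_add hX.le ((measure_union_le _ _).trans ?_)
        refine add_le_add (measure_copySet_le h p k 0) ((measure_biUnion_finset_le _ _).trans ?_)
        exact Finset.sum_le_sum fun d _ => measure_copySet_le h p k _
    _ = 5 * c := by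
        rw [Finset.sum_const, Finset.card_range, nsmul_eq_mul]; push_cast; ring
    _ ≤ _ := by
        refine mul_le_mul_right ?_ 5
        rw [show c = _ from (measure_copySet h hp k (blockLen p k + p ^ k + 1 * blockLen p k)).symm]
        exact measure_mono (copySet_subset p k)

/-- The sequences some translate of which is a threefold repetition on arbitrarily long
intervals. -/
def repetitiveSet : Set (ℤ → Letter) :=
  {w | ∃ j : ℤ, ∃ᶠ q in Filter.atTop, RepeatsThrice (shift j w) q}

theorem measurableSet_repetitiveSet : MeasurableSet repetitiveSet := by
  simp only [repetitiveSet, Filter.frequently_atTop, Set.ofPred_exists, Set.ofPred_forall,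
    Set.ofPred_and]
  exact .iUnion fun j => .iInter fun N => .iUnion fun q => .inter (.const _)
    (measurable_shift j (measurableSet_repeatsThrice q))

theorem shift_mem_repetitiveSet_iff (k : ℤ) (w : ℤ → Letter) :
    shift k w ∈ repetitiveSet ↔ w ∈ repetitiveSet := by
  simp only [repetitiveSet, Set.mem_ofPred_eq, shift_shift]
  exact (Equiv.addRight k).exists_congr_left.trans (by simp)

theorem ae_mem_repetitiveSet {p : ℕ} (hp : 5 < p) {ν : Measure (ℤ → Letter)}
    (hν : IsNonatomicInvariantMeasure (rho p) Letter.a ν) : ∀ᵐ w ∂ν, w ∈ repetitiveSet := by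
  have hmeas := measurableSet_repetitiveSet
  -- The exceptional set is shift-invariant, so the restricted measure is again invariant and the
  -- one-fifth bound applies to it.
  set μ := ν.restrict repetitiveSetᶜ
  have hle : μ ≤ ν := Measure.restrict_le_self
  have hinv : MeasurePreserving (shift 1) μ μ := by
    have := hν.invariant.restrict_preimage hmeas.compl
    rwa [show shift 1 ⁻¹' repetitiveSetᶜ = repetitiveSetᶜ from
      Set.ext fun w => not_congr (shift_mem_repetitiveSet_iff 1 w)] at this
  have hX : μ (substSubshift (rho p))ᶜ = 0 :=
    le_antisymm ((hle _).trans_eq hν.concentrated) zero_le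
  have hclopen : IsClopen cylinderB := (isClopen_discrete {Letter.b}).preimage (continuous_apply 0)
  have hfin : μ cylinderB ≠ ∞ :=
    ((hle _).trans_lt (hν.finite_of_isClopen _ hclopen (by simp [cylinderB, constSeq]))).ne
  set S : ℕ → Set (ℤ → Letter) := fun N =>
    ⋃ k ≥ N, cylinderB ∩ {w | RepeatsThrice w (blockLen p k)}
  have hS : ∀ N, MeasurableSet (S N) := fun N => .iUnion fun k => .iUnion fun _ =>
    measurableSet_cylinderB.inter (measurableSet_repeatsThrice _)
  have hSanti : Antitone S := fun N M h => Set.biUnion_subset_biUnion_left fun k hk => h.trans hk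
  have hSB : ∀ N, S N ⊆ cylinderB := fun N => Set.iUnion₂_subset fun _ _ => Set.inter_subset_left
  -- Continuity from above requires finite mass of the cylinder of b, which holds because that
  -- clopen set avoids a^ℤ.
  have hlim := tendsto_measure_iInter_atTop (μ := μ) (fun N => (hS N).nullMeasurableSet) hSanti
    ⟨0, ((measure_mono (hSB 0)).trans_lt hfin.lt_top).ne⟩
  have hSsub : ⋂ N, S N ⊆ repetitiveSet := by
    intro w hw
    refine ⟨0, Filter.frequently_atTop.2 fun N => ?_⟩
    obtain ⟨k, hk, -, hw⟩ := Set.mem_iUnion₂.1 (Set.mem_iInter.1 hw N)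
    refine ⟨blockLen p k, (hk.le.trans (lt_blockLen p k).le), ?_⟩
    rwa [show shift 0 w = w from funext fun i => congrArg w (add_zero i)]
  have hzero : μ (⋂ N, S N) = 0 := by
    refine measure_mono_null hSsub ?_
    rw [Measure.restrict_apply hmeas, Set.inter_compl_self, measure_empty]
  have hB : μ cylinderB = 0 := by
    rw [hzero] at hlim
    have hlim5 := ENNReal.Tendsto.const_mul hlim (.inr (by norm_num : (5 : ℝ≥0∞) ≠ ∞))
    rw [mul_zero] at hlim5
    refine le_antisymm (ge_of_tendsto' hlim5 fun N => ?_) zero_le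
    refine (measure_cylinderB_le hp hinv hX N).trans (mul_le_mul_right (measure_mono ?_) 5)
    exact Set.subset_biUnion_of_mem (u := fun k => cylinderB ∩
      {w | RepeatsThrice w (blockLen p k)}) (show N ∈ {k | k ≥ N} from le_refl N)
  have huniv : μ Set.univ = 0 := by
    -- Any sequence other than a^ℤ has a b somewhere; a^ℤ itself is null since ν has no atoms.
    have hcov : Set.univ ⊆ {constSeq Letter.a} ∪ ⋃ j : ℤ, shift j ⁻¹' cylinderB := by
      intro w _
      by_cases hw : ∃ j, w j = .b
      · obtain ⟨j, hj⟩ := hw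
        exact .inr (Set.mem_iUnion.2 ⟨j, by simpa [cylinderB, shift] using hj⟩)
      · refine .inl (funext fun j => ?_)
        cases h : w j with
        | a => rfl
        | b => exact absurd ⟨j, h⟩ hw
    refine measure_mono_null hcov (measure_union_null ?_ (measure_iUnion_null fun j => ?_))
    · exact le_antisymm ((hle _).trans_eq (hν.nonatomic _)) zero_le
    · rw [measure_preimage_shift hinv j measurableSet_cylinderB, hB]
  rw [ae_iff]
  rwa [Measure.restrict_apply .univ, Set.univ_inter] at huniv

/-! ### Construction of an invariant measure -/

/-- On a ring of clopen subsets of a compact space, a pointwise limit of measures extends to a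
measure. -/
theorem exists_measure_of_tendsto {α ι : Type*} [TopologicalSpace α] [CompactSpace α]
    [MeasurableSpace α] [OpensMeasurableSpace α] {C : Set (Set α)} (hC : IsSetRing C)
    (hclopen : ∀ s ∈ C, IsClopen s) (hgen : ‹MeasurableSpace α› = MeasurableSpace.generateFrom C)
    {l : Filter ι} [l.NeBot] {μ : ι → Measure α} {m : Set α → ℝ≥0∞}
    (h : ∀ s ∈ C, Filter.Tendsto (fun k => μ k s) l (nhds (m s))) :
    ∃ ν : Measure α, ∀ s ∈ C, ν s = m s := by
  have hempty : m ∅ = 0 := by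
    refine tendsto_nhds_unique (h ∅ hC.empty_mem) ?_
    simp
  have hunion : ∀ {s t : Set α}, s ∈ C → t ∈ C → Disjoint s t → m (s ∪ t) = m s + m t := by
    intro s t hs ht hst
    refine tendsto_nhds_unique (h _ (hC.union_mem hs ht)) (((h s hs).add (h t ht)).congr ?_)
    exact fun k => (measure_union hst (hclopen t ht).isOpen.measurableSet).symm
  let M : AddContent ℝ≥0∞ C := hC.addContent_of_union m hempty hunion
  have hM : M.IsSigmaSubadditive := by
    intro f hf hU
    -- A countable cover of a clopen set by ring members has a finite subcover, so finite
    -- subadditivity passes to the limit.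
    obtain ⟨t, ht⟩ := (hclopen _ hU).isClosed.isCompact.elim_finite_subcover f
      (fun i => (hclopen _ (hf i)).isOpen) le_rfl
    refine le_trans ?_ (ENNReal.sum_le_tsum t)
    refine le_of_tendsto_of_tendsto' (h _ hU) (tendsto_finsetSum t fun i _ => h _ (hf i)) ?_
    exact fun k => (measure_mono ht).trans (measure_biUnion_finset_le _ _)
  exact ⟨M.measure hC.isSetSemiring hgen.le hM, fun s hs => M.measure_eq hC.isSetSemiring hgen hM hs⟩

instance : BorelSpace Letter := ⟨borel_eq_top_of_discrete.symm⟩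

/-- The clopen sets that do not contain the constant sequence `a`. -/
def clopenRing : Set (Set (ℤ → Letter)) := {C | IsClopen C ∧ constSeq Letter.a ∉ C}

theorem isSetRing_clopenRing : IsSetRing clopenRing where
  empty_mem := ⟨isClopen_empty, Set.notMem_empty _⟩
  union_mem _ _ hs ht := ⟨hs.1.union ht.1, fun h => h.elim hs.2 ht.2⟩
  sdiff_mem _ _ hs ht := ⟨hs.1.diff ht.1, fun h => hs.2 h.1⟩

theorem apply_eq_b_mem_clopenRing (j : ℤ) : {w : ℤ → Letter | w j = .b} ∈ clopenRing :=
  ⟨(isClopen_discrete {Letter.b}).preimage (continuous_apply j), by simp [constSeq]⟩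

theorem cylinderB_mem_clopenRing : cylinderB ∈ clopenRing := apply_eq_b_mem_clopenRing 0

theorem generateFrom_clopenRing :
    (MeasurableSpace.pi : MeasurableSpace (ℤ → Letter)) =
      MeasurableSpace.generateFrom clopenRing := by
  refine le_antisymm (iSup_le fun j => ?_)
    (MeasurableSpace.generateFrom_le fun s hs => hs.1.isOpen.measurableSet)
  rw [← measurable_iff_comap_le]
  have hb : MeasurableSet[MeasurableSpace.generateFrom clopenRing] {w : ℤ → Letter | w j = .b} :=
    MeasurableSpace.measurableSet_generateFrom (apply_eq_b_mem_clopenRing j)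
  refine @measurable_to_countable' _ _ _ _ (MeasurableSpace.generateFrom clopenRing) _ fun c => ?_
  cases c with
  | b => exact hb
  | a =>
    convert hb.compl using 1
    ext w
    cases h : w j <;> simp [h]

theorem subset_iUnion_apply_eq_b {C : Set (ℤ → Letter)} (hC : C ∈ clopenRing) :
    ∃ t : Finset ℤ, C ⊆ ⋃ j ∈ t, {w | w j = .b} := by
  refine hC.1.isClosed.isCompact.elim_finite_subcover _
    (fun j => (apply_eq_b_mem_clopenRing j).1.isOpen) fun w hw => ?_
  by_contra h
  simp only [Set.mem_iUnion, not_exists, Set.mem_ofPred_eq] at h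
  refine hC.2 ?_
  rwa [show constSeq Letter.a = w from funext fun j => ?_]
  cases hj : w j with
  | a => rfl
  | b => exact absurd hj (h j)

theorem zero_mem_positionsB (p k : ℕ) : 0 ∈ positionsB p k := by
  simp [positionsB, blockLen_pos, rightSeq_zero]

theorem strictMono_card_positionsB (p : ℕ) : StrictMono fun k => (positionsB p k).card := by
  refine strictMono_nat_of_lt_succ fun k => Finset.card_lt_card ?_
  have hs := blockLen_succ p k
  have hL := blockLen_pos p k
  refine Finset.ssubset_iff_of_subset (fun j hj => ?_) |>.2
    ⟨blockLen p k + p ^ k + 0 * blockLen p k + 0, ?_, ?_⟩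
  · simp only [positionsB, Finset.mem_filter, Finset.mem_range] at hj ⊢
    exact ⟨by omega, hj.2⟩
  · simp only [positionsB, Finset.mem_filter, Finset.mem_range]
    exact ⟨by omega, by rw [rightSeq_copy p k (by omega) hL, rightSeq_zero]⟩
  · simp [positionsB]

/-- The measures counting the first translates of `wbar p`, weighted by the number of letters `b`
in `ρ ^ k (b)`. -/
noncomputable def countingMeasure (p k : ℕ) : Measure (ℤ → Letter) :=
  ((positionsB p k).card : ℝ≥0∞)⁻¹ •
    ∑ i ∈ Finset.range (blockLen p k), Measure.dirac (shift (i : ℤ) (wbar p))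

theorem countingMeasure_apply (p k : ℕ) {s : Set (ℤ → Letter)} (hs : MeasurableSet s) :
    countingMeasure p k s = ((positionsB p k).card : ℝ≥0∞)⁻¹ *
      ∑ i ∈ Finset.range (blockLen p k), s.indicator 1 (shift (i : ℤ) (wbar p)) := by
  simp [countingMeasure, Measure.dirac_apply' _ hs]

theorem countingMeasure_cylinderB (p k : ℕ) : countingMeasure p k cylinderB = 1 := by
  rw [countingMeasure_apply p k measurableSet_cylinderB]
  have : ∀ i : ℕ, cylinderB.indicator (1 : (ℤ → Letter) → ℝ≥0∞) (shift (i : ℤ) (wbar p)) =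
      if rightSeq p i = .b then 1 else 0 := fun i => by
    simp [Set.indicator_apply, cylinderB, shift, wbar_natCast]
  simp only [this, Finset.sum_boole]
  refine ENNReal.inv_mul_cancel ?_ (ENNReal.natCast_ne_top _)
  exact_mod_cast (Finset.card_pos.2 ⟨0, zero_mem_positionsB p k⟩).ne'

theorem countingMeasure_substSubshift_compl {p : ℕ} (hp : 5 < p) (k : ℕ) :
    countingMeasure p k (substSubshift (rho p))ᶜ = 0 := by
  rw [countingMeasure_apply p k (isClosed_substSubshift p).measurableSet.compl]
  simp [shift_mem_substSubshift (wbar_mem p hp)]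

/-- Shifting a sum over consecutive translates changes only its two end terms, each of weight at
most one over the number of b's. -/
theorem countingMeasure_preimage_shift (p k : ℕ) {s : Set (ℤ → Letter)} (hs : MeasurableSet s) :
    countingMeasure p k (shift 1 ⁻¹' s) +
        ((positionsB p k).card : ℝ≥0∞)⁻¹ * s.indicator 1 (wbar p) =
      countingMeasure p k s +
        ((positionsB p k).card : ℝ≥0∞)⁻¹ * s.indicator 1 (shift (blockLen p k : ℤ) (wbar p)) := by
  rw [countingMeasure_apply p k hs, countingMeasure_apply p k (measurable_shift 1 hs), ← mul_add,
    ← mul_add, ← Finset.sum_range_succ, Finset.sum_range_succ']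
  congr 2
  · refine Finset.sum_congr rfl fun i _ => ?_
    rw [Nat.cast_succ, add_comm (i : ℤ), ← shift_shift]
    rfl
  · congr 1
    exact funext fun i => congrArg (wbar p) (by simp)

/-- Since [0, ∞] is compact, an ultrafilter limit exists for all sets at once; the end terms vanish
in the limit, which makes it shift-invariant. -/
theorem exists_limit_countingMeasure (p : ℕ) : ∃ m : Set (ℤ → Letter) → ℝ≥0∞,
    (∀ s, Filter.Tendsto (fun k => countingMeasure p k s) (Filter.hyperfilter ℕ) (nhds (m s))) ∧
    ∀ s, MeasurableSet s → m (shift 1 ⁻¹' s) = m s := by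
  refine ⟨fun s => ((Filter.hyperfilter ℕ).map fun k => countingMeasure p k s).lim,
    fun s => Ultrafilter.le_nhds_lim _, fun s hs => ?_⟩
  have hlim : ∀ s, Filter.Tendsto (fun k => countingMeasure p k s) (Filter.hyperfilter ℕ)
    (nhds ((Filter.hyperfilter ℕ).map fun k => countingMeasure p k s).lim) :=
    fun s => Ultrafilter.le_nhds_lim _
  have hN : Filter.Tendsto (fun k => ((positionsB p k).card : ℝ≥0∞)⁻¹) (Filter.hyperfilter ℕ)
      (nhds 0) :=
    (ENNReal.tendsto_inv_nat_nhds_zero.comp (strictMono_card_positionsB p).tendsto_atTop).mono_left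
      Nat.hyperfilter_le_atTop
  have hsmall : ∀ f : ℕ → (ℤ → Letter), Filter.Tendsto
      (fun k => ((positionsB p k).card : ℝ≥0∞)⁻¹ * s.indicator 1 (f k)) (Filter.hyperfilter ℕ)
      (nhds 0) := fun f => by
    refine tendsto_of_tendsto_of_tendsto_of_le_of_le tendsto_const_nhds hN (fun _ => zero_le)
      fun k => mul_le_of_le_one_right' ?_
    exact Set.indicator_le_self' (f := (1 : (ℤ → Letter) → ℝ≥0∞)) (fun _ _ => zero_le) _
  have h1 := (hlim (shift 1 ⁻¹' s)).add (hsmall fun _ => wbar p)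
  have h2 := (hlim s).add (hsmall fun k => shift (blockLen p k : ℤ) (wbar p))
  simp only [countingMeasure_preimage_shift p _ hs, add_zero] at h1 h2
  exact tendsto_nhds_unique h1 h2

/-- A period d is impossible: in B_{d+1} the last b of the initial B_d is followed by p^d > d
letters a, so the letter d places later is a. -/
theorem shift_injective_of_mem {p : ℕ} (hp : 5 < p) {w : ℤ → Letter}
    (hw : w ∈ substSubshift (rho p)) {i : ℤ} (hi : w i = .b) :
    Function.Injective fun k : ℤ => shift k w := by
  have key : ∀ x d : ℤ, 0 < d → shift x w ≠ shift (x + d) w := by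
    intro x d hd h
    obtain ⟨j, -, -, hj⟩ := exists_blockAt hw hi (d.toNat + 1)
    have hL := blockLen_pos p d.toNat
    have hs := blockLen_succ p d.toNat
    have hlt : d.toNat < p ^ d.toNat := Nat.lt_pow_self (by omega)
    have h1 := hj (blockLen p d.toNat - 1) (by omega)
    have h2 := hj (blockLen p d.toNat + (d.toNat - 1)) (by omega)
    rw [rightSeq_last] at h1
    rw [rightSeq_gap p _ (by omega)] at h2
    have h3 := congrFun h (i - j + (blockLen p d.toNat - 1 : ℕ) - x)
    simp only [shift, sub_add_cancel] at h3
    rw [h1, show i - j + ((blockLen p d.toNat - 1 : ℕ) : ℤ) - x + (x + d) =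
      i - j + ((blockLen p d.toNat + (d.toNat - 1) : ℕ) : ℤ) by omega, h2] at h3
    cases h3
  intro x y h
  rcases lt_trichotomy x y with hlt | heq | hlt
  · exact absurd (by simpa using h) (key x (y - x) (by omega))
  · exact heq
  · exact absurd (by simpa using h.symm) (key y (x - y) (by omega))

/-- All translates of w are distinct and have equal mass, and arbitrarily many of them lie in the
cylinder of b, whose mass is finite. -/
theorem measure_singleton_eq_zero {p : ℕ} (hp : 5 < p) {ν : Measure (ℤ → Letter)}
    (h : MeasurePreserving (shift 1) ν ν) (hfin : ν cylinderB ≠ ∞) {w : ℤ → Letter}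
    (hw : w ∈ substSubshift (rho p)) {i : ℤ} (hi : w i = .b) : ν {w} = 0 := by
  have hinj := shift_injective_of_mem hp hw hi
  have hone : ∀ x : ℤ, ν {shift x w} = ν {w} := fun x => by
    rw [← measure_preimage_shift h x (measurableSet_singleton _)]
    congr 1
    ext v
    simp only [Set.mem_preimage, Set.mem_singleton_iff]
    refine ⟨fun hv => funext fun n => ?_, fun hv => hv ▸ rfl⟩
    simpa [shift] using congrFun hv (n - x)
  have hle : ∀ k : ℕ, (k : ℝ≥0∞) * ν {w} ≤ ν cylinderB := by
    intro k
    obtain ⟨j, -, -, hj⟩ := exists_blockAt hw hi k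
    have hsub : (⋃ x ∈ positionsB p k, {shift (i - j + x) w}) ⊆ cylinderB := by
      refine Set.iUnion₂_subset fun x hx => ?_
      simp only [positionsB, Finset.mem_filter, Finset.mem_range] at hx
      rw [Set.singleton_subset_iff]
      show w (0 + (i - j + x)) = .b
      rw [zero_add, hj x hx.1, hx.2]
    have hsum := measure_mono (μ := ν) hsub
    rw [measure_biUnion_finset ?_ fun _ _ => measurableSet_singleton _] at hsum
    · simp only [hone, Finset.sum_const, nsmul_eq_mul] at hsum
      refine le_trans (mul_le_mul_left ?_ _) hsum
      exact_mod_cast (strictMono_card_positionsB p).le_apply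
    · intro x _ y _ hne
      refine Set.disjoint_singleton.2 fun hxy => hne ?_
      have := hinj hxy
      omega
  by_contra h0
  have htop : Filter.Tendsto (fun k : ℕ => (k : ℝ≥0∞) * ν {w}) Filter.atTop (nhds ∞) := by
    have := ENNReal.Tendsto.mul_const ENNReal.tendsto_nat_nhds_top (b := ν {w}) (.inl (by simp))
    rwa [ENNReal.top_mul h0] at this
  exact hfin (top_le_iff.1 (le_of_tendsto' htop hle))

theorem exists_isNonatomicInvariantMeasure (p : ℕ) (hp : 5 < p) :
    ∃ ν : Measure (ℤ → Letter), IsNonatomicInvariantMeasure (rho p) Letter.a ν := by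
  obtain ⟨m, hm, hminv⟩ := exists_limit_countingMeasure p
  obtain ⟨ν₀, hν₀⟩ := exists_measure_of_tendsto isSetRing_clopenRing (fun s hs => hs.1)
    generateFrom_clopenRing fun s _ => hm s
  set c := constSeq Letter.a
  -- The ring does not see the point a^ℤ, so the extension is not controlled there and the point is
  -- removed.
  set ν := ν₀.restrict {c}ᶜ
  have hν : ∀ s ∈ clopenRing, ν s = m s := fun s hs => by
    rw [Measure.restrict_apply hs.1.isOpen.measurableSet, ← hν₀ s hs,
      Set.inter_eq_left.2 (Set.subset_compl_singleton_iff.2 hs.2)]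
  have hc : ν {c} = 0 := by
    rw [Measure.restrict_apply (measurableSet_singleton c), Set.inter_compl_self, measure_empty]
  have hcshift : shift 1 ⁻¹' {c} = {c} := by
    ext w
    refine ⟨fun hw => funext fun n => ?_, fun hw => by rw [hw]; rfl⟩
    simpa [shift, c, constSeq] using congrFun hw (n - 1)
  have hshift : ∀ s ∈ clopenRing, shift 1 ⁻¹' s ∈ clopenRing := fun s hs =>
    ⟨hs.1.preimage (continuous_pi fun _ => continuous_apply _), hs.2⟩
  have hB : ν cylinderB = 1 := by
    rw [hν _ cylinderB_mem_clopenRing]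
    refine tendsto_nhds_unique (hm _) ?_
    simp only [countingMeasure_cylinderB]
    exact tendsto_const_nhds
  have hBj : ∀ j : ℤ, ν {w | w j = .b} = 1 := by
    have hstep : ∀ j : ℤ, ν {w | w (j + 1) = .b} = ν {w | w j = .b} := fun j => by
      have hj := apply_eq_b_mem_clopenRing j
      rw [hν _ hj, ← hminv _ hj.1.isOpen.measurableSet, ← hν _ (hshift _ hj)]
      rfl
    intro j
    induction j using Int.induction_on with
    | zero => exact hB
    | succ n ih => rw [hstep, ih]
    | pred n ih => rw [← hstep, sub_add_cancel, ih]
  have hfin : ∀ C ∈ clopenRing, ν C < ∞ := fun C hC => by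
    obtain ⟨t, ht⟩ := subset_iUnion_apply_eq_b hC
    refine ((measure_mono ht).trans (measure_biUnion_finset_le _ _)).trans_lt ?_
    simp only [hBj, Finset.sum_const, nsmul_eq_mul, mul_one]
    exact ENNReal.natCast_lt_top _
  have hinv : MeasurePreserving (shift 1) ν ν := by
    refine ⟨measurable_shift 1, Eq.symm ?_⟩
    -- The measure may be infinite, so uniqueness needs a countable cover by sets of finite mass.
    -- The singleton of a^ℤ is adjoined because no member of the ring contains that point.
    refine Measure.ext_of_generateFrom_of_cover_subset (S := insert {c} clopenRing)
      (T := insert {c} (Set.range fun j : ℤ => {w | w j = Letter.b})) ?_ ?_ ?_ ?_ ?_ ?_ ?_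
    · refine le_antisymm ?_ (MeasurableSpace.generateFrom_le ?_)
      · exact generateFrom_clopenRing.le.trans
          (MeasurableSpace.generateFrom_mono (Set.subset_insert _ _))
      · rintro s (rfl | hs)
        · exact measurableSet_singleton c
        · exact hs.1.isOpen.measurableSet
    · rintro s (rfl | hs) t (rfl | ht) hne
      · rw [Set.inter_self]; exact .inl rfl
      · obtain ⟨_, rfl, h⟩ := hne
        exact absurd h ht.2
      · obtain ⟨_, h, rfl⟩ := hne
        exact absurd h hs.2
      · exact .inr (isSetRing_clopenRing.inter_mem hs ht)
    · refine Set.insert_subset_insert ?_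
      rintro _ ⟨j, rfl⟩
      exact apply_eq_b_mem_clopenRing j
    · exact (Set.countable_range _).insert _
    · rw [Set.eq_univ_iff_forall]
      intro w
      by_cases hw : ∃ j, w j = .b
      · obtain ⟨j, hj⟩ := hw
        exact ⟨_, .inr ⟨j, rfl⟩, hj⟩
      · refine ⟨_, .inl rfl, funext fun j => ?_⟩
        cases h : w j with
        | a => rfl
        | b => exact absurd ⟨j, h⟩ hw
    · rintro s (rfl | ⟨j, rfl⟩)
      · rw [hc]; exact ENNReal.zero_ne_top
      · rw [hBj]; exact ENNReal.one_ne_top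
    · rintro s (rfl | hs)
      · rw [Measure.map_apply (measurable_shift 1) (measurableSet_singleton c), hcshift]
      · rw [Measure.map_apply (measurable_shift 1) hs.1.isOpen.measurableSet, hν _ (hshift s hs),
          hminv s hs.1.isOpen.measurableSet, hν s hs]
  have hX : ν (substSubshift (rho p))ᶜ = 0 := by
    rw [substSubshift_rho_eq_iInter, Set.compl_iInter]
    refine measure_iUnion_null fun i => ?_
    rw [Set.compl_iInter]
    refine measure_iUnion_null fun n => ?_
    -- The complement of a window set is clopen, misses a^ℤ and is null for every counting measure,
    -- hence also in the limit.
    have hsub := Set.compl_subset_compl.2 (substSubshift_subset_windowSet p i n)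
    rw [hν _ ⟨(isClopen_windowSet p i n).compl, fun h =>
      h (substSubshift_subset_windowSet p i n (constSeq_mem p hp))⟩]
    refine tendsto_nhds_unique (hm _) (tendsto_const_nhds.congr fun k => ?_)
    exact (measure_mono_null hsub (countingMeasure_substSubshift_compl hp k)).symm
  refine ⟨ν, fun h => by simp [h] at hB, hX, hinv, fun w => ?_, fun C h1 h2 => hfin C ⟨h1, h2⟩⟩
  by_cases hw : w ∈ substSubshift (rho p)
  · by_cases hwb : ∃ j, w j = .b
    · obtain ⟨j, hj⟩ := hwb
      exact measure_singleton_eq_zero hp hinv (by rw [hB]; exact ENNReal.one_ne_top) hw hj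
    · rw [show w = c from funext fun j => ?_, hc]
      cases h : w j with
      | a => rfl
      | b => exact absurd ⟨j, h⟩ hwb
  · exact measure_mono_null (Set.singleton_subset_iff.2 hw) hX

theorem theorem1p2 (p : ℕ) (hp : 5 < p) :
    IsAlmostPrimitive (rho p) Letter.a ∧
    wbar p ∈ substSubshiftEP (rho p) \ {constSeq Letter.a} ∧
    closure (orbit (wbar p)) = substSubshift (rho p) ∧
    (∃ ν : MeasureTheory.Measure (ℤ → Letter), IsNonatomicInvariantMeasure (rho p) Letter.a ν) ∧
    ∃ V : Letter → ℝ, Function.Injective V ∧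
      (∃ (E : ℝ) (ψ : L2Z),
        IsEigenvector (schrodinger V (wbar p)) E ψ ∧ ExponentiallyDecaying ψ) ∧
      (∀ w ∈ orbit (wbar p), ∃ (E : ℝ) (ψ : L2Z),
        IsEigenvector (schrodinger V w) E ψ ∧ ExponentiallyDecaying ψ) ∧
      (∀ ν : MeasureTheory.Measure (ℤ → Letter),
        IsNonatomicInvariantMeasure (rho p) Letter.a ν →
        ∀ᵐ w ∂ν, purePointSpectrum (schrodinger V w) = ∅) := by
  obtain ⟨V, hV, E, ψ, hψ, hdecay⟩ := exists_eigenvector_wbar p hp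
  refine ⟨isAlmostPrimitive_rho p hp, wbar_mem_diff p hp, closure_orbit_wbar p hp,
    exists_isNonatomicInvariantMeasure p hp, V, hV, ⟨E, ψ, hψ, hdecay⟩, ?_, fun ν hν => ?_⟩
  · rintro _ ⟨k, rfl⟩
    exact ⟨E, translateL2 k ψ, exists_eigenvector_shift V hψ k, hdecay.translate k⟩
  · filter_upwards [ae_mem_repetitiveSet hp hν] with w hw
    exact purePointSpectrum_eq_empty V hw
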